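/- Let $T$ be a torus with Lie algebra $\mathfrak t$, let $M$ be a (Hausdorff, finite-dimensional, smooth) manifold with a smooth action of $T$, and let $Q\subseteq T$ be a subtorus, with Lie algebra $\mathfrak q$, that acts freely on $M$. Let $\pi\colon M\to M/Q$ be the projection and let $T/Q$, with Lie algebra $\mathfrak t/\mathfrak q$, act on $M/Q$ by the residual action. For a torus $G$ acting on a space $N$ and $p\in N$, let $\mathfrak g_p\subseteq\mathfrak g$ be the Lie algebra of the stabilizer of $p$. The infinitesimal strata of $N$ are the connected components $X$ of the sets $\{p\in N:\mathfrak g_p=\mathfrak h\}$, $\mathfrak h\subseteq\mathfrak g$; write $\mathfrak g_X$ for the common infinitesimal stabilizer of the points of $X$, and $X\preccurlyeq Y$ if $X\subseteq\overline Y$ (then $\mathfrak g_Y\subseteq\mathfrak g_X$). A polynomial assignment of degree $2k$ is a function $A$ that attaches to each infinitesimal stratum $X$ a homogeneous polynomial $A(X)$ of degree $k$ on $\mathfrak g_X$ such that $A(Y)=A(X)|_{\mathfrak g_Y}$ whenever $X\preccurlyeq Y$. These form a vector space $\mathcal A^{2k}_G(N)$, and $\mathcal A_G(N)=\bigoplus_k\mathcal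 A_G^{2k}(N)$ is a graded $\mathbb R$-algebra. Then: 1. Let $X$ be an infinitesimal stratum of $M/Q$, write $(\mathfrak t/\mathfrak q)_X=\mathfrak k_X/\mathfrak q$, and let $K_X=\exp\mathfrak k_X$. Then $K_X$ contains $Q$ and has Lie algebra $\mathfrak k_X$, and there is a unique homomorphism $\rho_X\colon K_X\to Q$ such that $\rho_X(a)\cdot p=a\cdot p$ for all $a\in K_X$ and $p\in\pi^{-1}(\overline X)$; it is continuous and surjective. Let $T_X=\ker\rho_X$ and let $\mathfrak t_X$ be its Lie algebra. Then $\mathfrak k_X=\mathfrak t_X\oplus\mathfrak q$, and $\xi\mapsto\xi+\mathfrak q$ is a bijection $\mathfrak t_X\to(\mathfrak t/\mathfrak q)_X$, with inverse denoted $\varphi_X$. The set $\pi^{-1}(X)$ is an infinitesimal stratum of $M$. 2. Let $X$ be an infinitesimal stratum of $M$. The Lie algebra $\mathfrak k_X\supseteq\mathfrak q$ such that $\mathfrak k_X/\mathfrak q$ is the infinitesimal stabilizer of $\pi(p)$ is the same for all $p\in X$, and $\mathfrak k_X=\mathfrak t_X\oplus\mathfrak q$. Let $K_X=\exp\mathfrak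 k_X$. There is a unique homomorphism $\rho_X\colon K_X\to Q$ such that $a\cdot p=\rho_X(a)\cdot p$ for all $a\in K_X$ and $p\in X$; it is continuous and surjective, with kernel $\exp\mathfrak t_X$. The set $\pi(X)=X/Q$ is an infinitesimal stratum of $M/Q$, and $\psi_X\colon\xi\mapsto\xi+\mathfrak q$ is a bijection $\mathfrak t_X\to\mathfrak k_X/\mathfrak q=(\mathfrak t/\mathfrak q)_{\pi(X)}$. 3. There is an isomorphism of graded $\mathbb R$-algebras $\pi_*\colon\mathcal A_T(M)\to\mathcal A_{T/Q}(M/Q)$, with inverse $\sigma$, such that * for every infinitesimal stratum $X$ of $M/Q$ and every $A\in\mathcal A_T(M)$, $$(\pi_*A)(X)=\varphi_X^*\bigl(A(Z)|_{\mathfrak t_X}\bigr)$$ both for $Z=\pi^{-1}(X)$ and for every infinitesimal stratum $Z$ of $M$ that is open and dense in the connected component of $M^{T_X}$ containing $\pi^{-1}(X)$ (and $\mathfrak t_X\subseteq\mathfrak t_Z$ for these $Z$); * for every infinitesimal stratum $X$ of $M$ and every $B\in\mathcal A_{T/Q}(M/Q)$, $$\sigma(B)(X)=\psi_X^*\bigl(B(\widetilde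 X)|_{\mathfrak k_X/\mathfrak q}\bigr)$$ both for $\widetilde X=\pi(X)$ and for every infinitesimal stratum $\widetilde X$ of $M/Q$ that is open and dense in the connected component of $(M/Q)^{K_X/Q}$ containing $\pi(X)$ (and $\mathfrak k_X/\mathfrak q\subseteq(\mathfrak t/\mathfrak q)_{\widetilde X}$ for these $\widetilde X$). -/

import Mathlib

open scoped Manifold ContDiff

noncomputable section

namespace TorusAssignment

/-! ### Tori and their Lie algebras -/

/-- A torus: a topological group isomorphic to a finite power of the circle group. -/
def IsTorus (G : Type*) [CommGroup G] [TopologicalSpace G] : Prop :=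
  ∃ n : ℕ, Nonempty (G ≃ₜ* (Fin n → Circle))

/-- The Lie algebra of a commutative Lie group, realised as the group of its one-parameter
subgroups `γ : ℝ → G` (continuous homomorphisms), with pointwise addition. The exponential map
is `γ ↦ γ 1`, and `γ t = exp (t γ)`. -/
def LieAlg (G : Type*) [CommGroup G] [TopologicalSpace G] : Type _ :=
  Additive (Multiplicative ℝ →ₜ* G)

namespace LieAlg

variable {G : Type*} [CommGroup G] [TopologicalSpace G]

/-- `ξ.expAt t = exp (t ξ)`. -/
def expAt (ξ : LieAlg G) (t : ℝ) : G :=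
  (Additive.toMul (α := Multiplicative ℝ →ₜ* G) ξ) (Multiplicative.ofAdd t)

theorem ext {ξ η : LieAlg G} (h : ∀ t, ξ.expAt t = η.expAt t) : ξ = η :=
  ContinuousMonoidHom.ext (A := Multiplicative ℝ) (B := G) fun t => h (Multiplicative.toAdd t)

/-- The one-parameter subgroup given by a function `ℝ → G`. -/
def mk' (f : ℝ → G) (hf : Continuous f) (h0 : f 0 = 1) (hadd : ∀ s t, f (s + t) = f s * f t) :
    LieAlg G :=
  Additive.ofMul (α := Multiplicative ℝ →ₜ* G)
    { toFun := fun t => f (Multiplicative.toAdd t)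
      map_one' := h0
      map_mul' := fun _ _ => hadd _ _
      continuous_toFun := hf.comp continuous_toAdd }

@[simp] theorem expAt_mk' (f : ℝ → G) (hf : Continuous f) (h0 : f 0 = 1)
    (hadd : ∀ s t, f (s + t) = f s * f t) (t : ℝ) : (mk' f hf h0 hadd).expAt t = f t := rfl

@[simp] theorem expAt_zero_right (ξ : LieAlg G) : ξ.expAt 0 = 1 :=
  map_one (Additive.toMul (α := Multiplicative ℝ →ₜ* G) ξ)

theorem expAt_add_right (ξ : LieAlg G) (s t : ℝ) : ξ.expAt (s + t) = ξ.expAt s * ξ.expAt t :=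
  map_mul (Additive.toMul (α := Multiplicative ℝ →ₜ* G) ξ) _ _

theorem continuous_expAt (ξ : LieAlg G) : Continuous ξ.expAt :=
  (map_continuous (Additive.toMul (α := Multiplicative ℝ →ₜ* G) ξ)).comp continuous_ofAdd

variable [IsTopologicalGroup G]

instance : AddCommGroup (LieAlg G) :=
  inferInstanceAs (AddCommGroup (Additive (Multiplicative ℝ →ₜ* G)))

@[simp] theorem expAt_add (ξ η : LieAlg G) (t : ℝ) : (ξ + η).expAt t = ξ.expAt t * η.expAt t := rfl

@[simp] theorem expAt_zero (t : ℝ) : (0 : LieAlg G).expAt t = 1 := rfl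

@[simp] theorem expAt_neg (ξ : LieAlg G) (t : ℝ) : (-ξ).expAt t = (ξ.expAt t)⁻¹ := rfl

instance : SMul ℝ (LieAlg G) where
  smul c ξ := mk' (fun t => ξ.expAt (c * t)) (ξ.continuous_expAt.comp (continuous_const_mul c))
    (by simp) (fun _ _ => by rw [mul_add, expAt_add_right])

@[simp] theorem expAt_smul (c : ℝ) (ξ : LieAlg G) (t : ℝ) :
    (c • ξ).expAt t = ξ.expAt (c * t) := rfl

instance : Module ℝ (LieAlg G) where
  one_smul ξ := ext fun t => by simp
  mul_smul c d ξ := ext fun t => by simp [mul_comm, mul_left_comm]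
  smul_zero c := ext fun t => by simp
  smul_add c ξ η := ext fun t => by simp
  add_smul c d ξ := ext fun t => by simp [add_mul, expAt_add_right]
  zero_smul ξ := ext fun t => by simp

/-- The Lie algebra of a (closed) subgroup `H` of `G`, as a subspace of that of `G`. -/
def ofSubgroup (H : Subgroup G) : Submodule ℝ (LieAlg G) where
  carrier := {ξ | ∀ t, ξ.expAt t ∈ H}
  add_mem' hξ hη t := H.mul_mem (hξ t) (hη t)
  zero_mem' _ := H.one_mem
  smul_mem' c _ hξ t := hξ (c * t)

/-- The subgroup `exp 𝔥` of `G`. -/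
def expSubgroup (h : Submodule ℝ (LieAlg G)) : Subgroup G where
  carrier := {a | ∃ ξ ∈ h, ξ.expAt 1 = a}
  mul_mem' := by
    rintro _ _ ⟨ξ, hξ, rfl⟩ ⟨η, hη, rfl⟩
    exact ⟨ξ + η, h.add_mem hξ hη, rfl⟩
  one_mem' := ⟨0, h.zero_mem, rfl⟩
  inv_mem' := by
    rintro _ ⟨ξ, hξ, rfl⟩
    exact ⟨-ξ, h.neg_mem hξ, rfl⟩

/-- The linear map `𝔱 → 𝔱/𝔮` from the Lie algebra of `G` to that of `G ⧸ Q`, induced by the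
projection. -/
def toQuotient (Q : Subgroup G) : LieAlg G →ₗ[ℝ] LieAlg (G ⧸ Q) where
  toFun ξ := mk' (fun t => (ξ.expAt t : G ⧸ Q))
    (continuous_quot_mk.comp ξ.continuous_expAt) (by simp) (fun s t => by
      rw [expAt_add_right]; rfl)
  map_add' _ _ := rfl
  map_smul' _ _ := rfl

end LieAlg

/-! ### Homogeneous polynomials -/

/-- `𝕊ᵏ(V*)`: the homogeneous polynomial functions of degree `k` on `V`, i.e. the linear span of
the `k`-fold products of linear functionals. -/
def homogeneousPoly (V : Type*) [AddCommGroup V] [Module ℝ V] (k : ℕ) : Submodule ℝ (V → ℝ) :=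
  LinearMap.range (LinearMap.ltoFun ℝ V ℝ ℝ) ^ k

/-! ### Infinitesimal strata and assignments -/

section Strata

variable {G : Type*} [CommGroup G] [TopologicalSpace G] [IsTopologicalGroup G]
  {M : Type*} [MulAction G M]

/-- The infinitesimal stabilizer of a point: the Lie algebra of its stabilizer. -/
def infStab (p : M) : Submodule ℝ (LieAlg G) :=
  LieAlg.ofSubgroup (MulAction.stabilizer G p)

/-- The elements of the Lie algebra that lie in the infinitesimal stabilizer of every point
of `S`. -/
def infStabOn (S : Set M) : Submodule ℝ (LieAlg G) := ⨅ p ∈ S, infStab p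

variable (G M) in
/-- The infinitesimal strata of `M`: the connected components of the sets
`M^𝔥 = {q | 𝔱_q = 𝔥}`. -/
structure Stratum [TopologicalSpace M] where
  carrier : Set M
  exists_eq : ∃ (h : Submodule ℝ (LieAlg G)) (p : M), infStab p = h ∧
    carrier = connectedComponentIn {q | infStab q = h} p

variable [TopologicalSpace M]

/-- The common infinitesimal stabilizer of the points of a stratum. -/
def Stratum.lie (X : Stratum G M) : Submodule ℝ (LieAlg G) := infStabOn X.carrier

/-- All points of a stratum have the same infinitesimal stabilizer, namely `X.lie`. -/
theorem Stratum.infStab_eq (X : Stratum G M) {q : M} (hq : q ∈ X.carrier) :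
    infStab q = X.lie := by
  obtain ⟨h, p, hp, hX⟩ := X.exists_eq
  have key : ∀ x ∈ X.carrier, (infStab x : Submodule ℝ (LieAlg G)) = h := fun x hx => by
    rw [hX] at hx
    exact connectedComponentIn_subset {q : M | infStab q = h} p hx
  refine le_antisymm (le_iInf₂ fun x hx => ?_) (iInf₂_le q hq)
  rw [key q hq, key x hx]

/-- The order `X ≼ Y` of strata: `X` is contained in the closure of `Y`. -/
instance : LE (Stratum G M) := ⟨fun X Y => X.carrier ⊆ closure Y.carrier⟩

variable (G M) in
/-- Functions that attach to every stratum `X` a real function on `𝔱_X`. -/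
abbrev StratumFun : Type _ := (X : Stratum G M) → X.lie → ℝ

variable (G M) in
/-- The polynomial assignments of degree `2k`: families of homogeneous polynomials `A X` of
degree `k` on `𝔱_X` such that `A Y` is the restriction of `A X` to `𝔱_Y ⊆ 𝔱_X`
whenever `X ≼ Y`. -/
def assignments (k : ℕ) : Submodule ℝ (StratumFun G M) where
  carrier := {A | (∀ X, A X ∈ homogeneousPoly X.lie k) ∧
    ∀ X Y : Stratum G M, X ≤ Y → ∀ ξ (hY : ξ ∈ Y.lie) (hX : ξ ∈ X.lie),
      A Y ⟨ξ, hY⟩ = A X ⟨ξ, hX⟩}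
  add_mem' hA hB := ⟨fun X => Submodule.add_mem _ (hA.1 X) (hB.1 X), fun X Y h ξ hY hX => by
    simp [hA.2 X Y h ξ hY hX, hB.2 X Y h ξ hY hX]⟩
  zero_mem' := ⟨fun X => Submodule.zero_mem _, fun X Y h ξ hY hX => rfl⟩
  smul_mem' c A hA := ⟨fun X => Submodule.smul_mem _ c (hA.1 X), fun X Y h ξ hY hX => by
    simp [hA.2 X Y h ξ hY hX]⟩

theorem mul_mem_assignments {j k : ℕ} {A B : StratumFun G M} (hA : A ∈ assignments G M j)
    (hB : B ∈ assignments G M k) : A * B ∈ assignments G M (j + k) :=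
  ⟨fun X => by
    have := Submodule.mul_mem_mul (hA.1 X) (hB.1 X)
    rw [homogeneousPoly, homogeneousPoly, ← pow_add] at this
    exact this,
  fun X Y h ξ hY hX => by simp [hA.2 X Y h ξ hY hX, hB.2 X Y h ξ hY hX]⟩

theorem algebraMap_mem_assignments (c : ℝ) :
    algebraMap ℝ (StratumFun G M) c ∈ assignments G M 0 :=
  ⟨fun X => by
    rw [homogeneousPoly, pow_zero]
    exact Submodule.algebraMap_mem c,
  fun X Y h ξ hY hX => rfl⟩

variable (G M) in
/-- The graded `ℝ`-algebra `𝒜_G(M) = ⨁ₖ 𝒜_G^{2k}(M)` of polynomial assignments, as a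
subalgebra of the algebra of functions on strata (with pointwise operations). -/
def assignmentRing : Subalgebra ℝ (StratumFun G M) where
  toSubsemiring :=
    { carrier := ((⨆ k, assignments G M k : Submodule ℝ (StratumFun G M)) : Set (StratumFun G M))
      mul_mem' := by
        intro A B hA hB
        simp only [SetLike.mem_coe] at hA hB ⊢
        induction hA using Submodule.iSup_induction' with
        | mem j A hA =>
          induction hB using Submodule.iSup_induction' with
          | mem k B hB => exact Submodule.mem_iSup_of_mem (j + k) (mul_mem_assignments hA hB)
          | zero => rw [mul_zero]; exact Submodule.zero_mem _
          | add B C _ _ hB hC => rw [mul_add]; exact Submodule.add_mem _ hB hC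
        | zero => rw [zero_mul]; exact Submodule.zero_mem _
        | add A C _ _ hA hC => rw [add_mul]; exact Submodule.add_mem _ hA hC
      one_mem' := Submodule.mem_iSup_of_mem 0 (by
        simpa using algebraMap_mem_assignments (G := G) (M := M) 1)
      add_mem' := fun hA hB => Submodule.add_mem _ hA hB
      zero_mem' := Submodule.zero_mem _ }
  algebraMap_mem' c := Submodule.mem_iSup_of_mem 0 (algebraMap_mem_assignments c)

end Strata

/-- `Z` is contained, open and dense in `C`. -/
def IsOpenDenseIn {M : Type*} [TopologicalSpace M] (Z C : Set M) : Prop :=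
  Z ⊆ C ∧ C ⊆ closure Z ∧ ∃ U, IsOpen U ∧ Z = U ∩ C

/-! ### The quotient by a subgroup -/

section Quotient

variable {T : Type*} [CommGroup T] {M : Type*} [MulAction T M]

/-- The quotient `M/Q`; it carries the quotient topology. -/
abbrev QuotientSpace (Q : Subgroup T) (M : Type*) [MulAction T M] : Type _ :=
  MulAction.orbitRel.Quotient Q M

/-- The projection `π : M → M/Q`. -/
def proj (Q : Subgroup T) (p : M) : QuotientSpace Q M := Quotient.mk'' p

/-- The residual action of `T/Q` on `M/Q`. -/
instance residualAction (Q : Subgroup T) : MulAction (T ⧸ Q) (QuotientSpace Q M) where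
  smul a x := Quotient.liftOn₂' a x (fun a p => proj Q (a • p)) (by
    intro a p b q hab hpq
    rw [QuotientGroup.leftRel_apply] at hab
    rw [MulAction.orbitRel_apply] at hpq
    obtain ⟨c, rfl⟩ := hpq
    refine Quotient.sound' ?_
    rw [MulAction.orbitRel_apply]
    refine ⟨c * (⟨a⁻¹ * b, hab⟩ : Q)⁻¹, ?_⟩
    simp only [Subgroup.smul_def, Subgroup.coe_mul, Subgroup.coe_inv, smul_smul]
    congr 1
    simp [mul_comm, mul_left_comm])
  one_smul x := by
    induction x using Quotient.inductionOn'
    exact congrArg (proj Q) (one_smul T _)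
  mul_smul a b x := by
    induction a using Quotient.inductionOn'
    induction b using Quotient.inductionOn'
    induction x using Quotient.inductionOn'
    exact congrArg (proj Q) (mul_smul _ _ _)

theorem mk_smul_proj (Q : Subgroup T) (a : T) (p : M) :
    (a : T ⧸ Q) • proj Q p = proj Q (a • p) := rfl

variable [TopologicalSpace T] [IsTopologicalGroup T] (Q : Subgroup T)

/-- For `S ⊆ M/Q`, the Lie algebra `𝔨 ⊇ 𝔮` such that `𝔨/𝔮` is the infinitesimal stabilizer
in `𝔱/𝔮` of the points of `S`. -/
def fiberLie (S : Set (QuotientSpace Q M)) : Submodule ℝ (LieAlg T) :=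
  (infStabOn (G := T ⧸ Q) S).comap (LieAlg.toQuotient Q)

/-- The subtorus `K = exp 𝔨` of `T`, which contains `Q` and stabilizes the fibers over `S`. -/
def fiberTorus (S : Set (QuotientSpace Q M)) : Subgroup T :=
  LieAlg.expSubgroup (fiberLie Q S)

variable {Q}

/-- `ρ : K → Q` satisfies `ρ a • p = a • p` for all `a ∈ K` and `p ∈ P`. -/
def ActsThrough {K : Subgroup T} (ρ : K →* Q) (P : Set M) : Prop :=
  ∀ (a : K), ∀ p ∈ P, (ρ a : T) • p = (a : T) • p

/-- The kernel of `ρ : K → Q`, as a subgroup of `T`. -/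
def kernel {K : Subgroup T} (ρ : K →* Q) : Subgroup T := ρ.ker.map K.subtype

variable [TopologicalSpace M]

/-- `B X` and `A Z` correspond under `ξ ↦ ξ + 𝔮` on `h`: this map sends `h ⊆ 𝔱_Z` into
`(𝔱/𝔮)_X`, and pulls the polynomial `B X` back to the restriction of `A Z` to `h`. -/
def Corresponds (h : Submodule ℝ (LieAlg T)) (A : StratumFun T M) (Z : Stratum T M)
    (B : StratumFun (T ⧸ Q) (QuotientSpace Q M)) (X : Stratum (T ⧸ Q) (QuotientSpace Q M)) :
    Prop :=
  ∀ ξ ∈ h, ∃ (hX : LieAlg.toQuotient Q ξ ∈ X.lie) (hZ : ξ ∈ Z.lie),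
    B X ⟨LieAlg.toQuotient Q ξ, hX⟩ = A Z ⟨ξ, hZ⟩

end Quotient

end TorusAssignment

end

/-!
The argument is topological: it rests on the compactness of `T` and `Q`, the Hausdorff property of
`M` and the continuity of the action.

*The homomorphisms `ρ`.* Let `P` be a preconnected set of points whose `Q`-orbits are preserved by a
subgroup `K` of `T`. As `Q` acts freely, for each `p ∈ P` there is a unique homomorphism
`ρ_p : K → Q` with `ρ_p(a) p = a p`. Compactness of `Q` makes `ρ_p(a)` jointly continuous in `p` and
`a` (`continuous_of_smul_eq`). The group of all elements that preserve the `Q`-orbits of the points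
of `P` is closed, hence compact, and `Q` has no small subgroups, so `ρ_p` is locally constant in
`p` and therefore constant (`exists_actsThrough_fiberStabilizer`). The relation `ρ(a) p = a p`
extends to the closure of `P` because `M` is Hausdorff.

*Strata.* At every point the Lie algebra `𝔨` of the elements preserving the orbit `Q p` is
`𝔱_p ⊕ 𝔮` (`fiberLie_singleton`): a one-parameter group in it acts on `p` through a one-parameter
group in `Q`. The projection `𝔱 → 𝔱/𝔮` is surjective, since characters of `Q` extend to `T` and so
`Q` is a retract of `T` (`IsTorus.toQuotient_surjective`); hence the infinitesimal stabilizer of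
`π(p)` is the image of `𝔱_p` (`infStab_proj`), and `π` maps strata into strata. Conversely, on the
preimage of a stratum `X`, which is connected because `π` is open with connected fibers, `𝔱_p` is
the Lie algebra of `ker ρ_X` and does not depend on `p`. So `X ↦ π(X)` is a bijection of strata
with inverse `X ↦ π⁻¹(X)` (`preimage_stratumAt_proj`), it preserves and reflects the order, and
`ξ ↦ ξ + 𝔮` identifies `𝔱_X` with `(𝔱/𝔮)_{π(X)}`.

*Assignments.* Transport along this bijection is an isomorphism of algebras that preserves the
degree (`assignmentPullback`). A stratum `Z` that is open and dense in the component of the fixed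
point set through `X` satisfies `X ≼ Z`, so the compatibility condition identifies the values at `Z`
with those at `X` (`Stratum.le_and_lie_le_of_kernel`, `Stratum.image_le_and_lie_image_le`).
-/

namespace TorusAssignment

open Topology MeasureTheory

/-! ### Tori -/

section Tori

theorem circle_eq_one_of_forall_re_pos {z : Circle} (h : ∀ n : ℕ, 0 < ((z ^ n : Circle) : ℂ).re) :
    z = 1 := by
  have hsq : ∀ w : Circle, (w : ℂ).re ^ 2 + (w : ℂ).im ^ 2 = 1 := fun w => by
    have := w.normSq_coe
    rw [Complex.normSq_apply] at this
    nlinarith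
  have hle : ∀ w : Circle, (w : ℂ).re ≤ 1 := fun w => by nlinarith [hsq w, sq_nonneg (w : ℂ).im]
  -- Since `Re w² = 2 (Re w)² - 1`, each squaring at least doubles `1 - Re w` while `Re w > 0`.
  have hgrow : ∀ n : ℕ, 2 ^ n * (1 - (z : ℂ).re) ≤ 1 - ((z ^ 2 ^ n : Circle) : ℂ).re := by
    intro n
    induction n with
    | zero => simp
    | succ n ih =>
      set w := z ^ 2 ^ n with hw
      have h1 : ((z ^ 2 ^ (n + 1) : Circle) : ℂ).re = 2 * (w : ℂ).re ^ 2 - 1 := by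
        rw [pow_succ, pow_mul, ← hw, pow_two, Circle.coe_mul, Complex.mul_re]
        linarith [hsq w, sq_nonneg (w : ℂ).re, pow_two (w : ℂ).re, pow_two (w : ℂ).im]
      rw [h1, pow_succ]
      nlinarith [h (2 ^ n), hle w]
  have hre : (z : ℂ).re = 1 := by
    by_contra hne
    have hpos : 0 < 1 - (z : ℂ).re := by
      have := lt_of_le_of_ne (hle z) hne
      linarith
    obtain ⟨n, hn⟩ := pow_unbounded_of_one_lt (1 / (1 - (z : ℂ).re)) (one_lt_two (α := ℝ))
    rw [div_lt_iff₀ hpos] at hn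
    linarith [hgrow n, h (2 ^ n)]
  have him : (z : ℂ).im = 0 := by
    have := hsq z
    rw [hre] at this
    nlinarith
  exact Circle.ext (Complex.ext (by simpa using hre) (by simpa using him))

variable {G : Type*} [CommGroup G] [TopologicalSpace G]

theorem IsTorus.t2Space (hG : IsTorus G) : T2Space G := by
  obtain ⟨n, ⟨e⟩⟩ := hG
  exact e.toHomeomorph.symm.t2Space

theorem IsTorus.compactSpace (hG : IsTorus G) : CompactSpace G := by
  obtain ⟨n, ⟨e⟩⟩ := hG
  exact e.toHomeomorph.symm.compactSpace

theorem IsTorus.preconnectedSpace (hG : IsTorus G) : PreconnectedSpace G := by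
  obtain ⟨n, ⟨e⟩⟩ := hG
  have := isPreconnected_range e.toHomeomorph.symm.continuous
  rw [e.toHomeomorph.symm.surjective.range_eq] at this
  exact ⟨this⟩

/-- A torus has no small subgroups. -/
theorem IsTorus.exists_open_forall_subgroup_eq_bot (hG : IsTorus G) :
    ∃ U : Set G, IsOpen U ∧ 1 ∈ U ∧ ∀ H : Subgroup G, (H : Set G) ⊆ U → H = ⊥ := by
  obtain ⟨n, ⟨e⟩⟩ := hG
  refine ⟨{a | ∀ i, 0 < ((e a i : Circle) : ℂ).re}, ?_, ?_, fun H hH => ?_⟩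
  · rw [Set.ofPred_forall]
    refine isOpen_iInter_of_finite fun i => isOpen_lt continuous_const ?_
    exact Complex.continuous_re.comp
      (continuous_subtype_val.comp ((continuous_apply i).comp e.continuous))
  · intro i
    simp
  · rw [Subgroup.eq_bot_iff_forall]
    intro a ha
    apply e.injective
    rw [map_one]
    ext1 i
    refine circle_eq_one_of_forall_re_pos fun k => ?_
    have := hH (H.pow_mem ha k) i
    rwa [map_pow, Pi.pow_apply] at this

/-- The exponential map of a torus is surjective. -/
theorem IsTorus.exists_expAt_one_eq (hG : IsTorus G) (a : G) : ∃ ξ : LieAlg G, ξ.expAt 1 = a := by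
  obtain ⟨n, ⟨e⟩⟩ := hG
  choose θ hθ using fun i => Circle.exp_surjective (e a i)
  refine ⟨LieAlg.mk' (fun t => e.symm fun i => Circle.exp (t * θ i)) ?_ ?_ ?_, ?_⟩
  · refine e.symm.continuous.comp (continuous_pi fun i => Circle.exp.continuous.comp ?_)
    fun_prop
  · rw [← map_one e.symm]
    congr 1
    ext1 i
    simp
  · intro s t
    rw [← map_mul]
    congr 1
    ext1 i
    simp [add_mul, Circle.exp_add]
  · simp only [LieAlg.expAt_mk', one_mul, hθ]
    exact e.symm_apply_apply a

end Tori

/-! ### Extension of characters and lifting of one-parameter subgroups -/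

section Characters

variable {G : Type*} [CommGroup G] [TopologicalSpace G]

/-- A continuous character, as a continuous complex-valued function. -/
noncomputable def characterFun (χ : G →ₜ* Circle) : C(G, ℂ) := ⟨fun a => (χ a : ℂ), by fun_prop⟩

theorem characterFun_apply (χ : G →ₜ* Circle) (a : G) : characterFun χ a = χ a := rfl

theorem coe_character_inv_apply (χ : G →ₜ* Circle) (a : G) :
    ((χ⁻¹ a : Circle) : ℂ) = (starRingEnd ℂ) (χ a : ℂ) := Circle.coe_inv_eq_conj (χ a)

variable [IsTopologicalGroup G]

/-- On a compact commutative group, a group of continuous characters that separates points contains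
every continuous character: by Stone–Weierstrass its span is dense, while a character outside it
would be orthogonal to it with respect to the Haar measure. -/
theorem mem_of_separatesPoints_characters [CompactSpace G] (S : Subgroup (G →ₜ* Circle))
    (hS : ∀ a : G, (∀ ψ ∈ S, ψ a = 1) → a = 1) (χ : G →ₜ* Circle) : χ ∈ S := by
  by_contra hχ
  borelize G
  let μ : Measure G := Measure.haar
  have hint : ∀ f : C(G, ℂ), Integrable f μ := fun f =>
    (map_continuous f).integrable_of_hasCompactSupport (HasCompactSupport.of_compactSpace f)
  -- the linear functional `f ↦ ∫ f χ̄`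
  let Φ : C(G, ℂ) →ₗ[ℂ] ℂ :=
    { toFun := fun f => ∫ a, f a * (characterFun χ⁻¹) a ∂μ
      map_add' := fun f g => by
        simp only [ContinuousMap.add_apply, add_mul]
        exact integral_add (hint (f * characterFun χ⁻¹)) (hint (g * characterFun χ⁻¹))
      map_smul' := fun c f => by
        simp only [ContinuousMap.smul_apply, smul_eq_mul, mul_assoc, RingHom.id_apply]
        exact integral_const_mul _ _ }
  have hΦ_cont : Continuous Φ := by
    refine AddMonoidHomClass.continuous_of_bound Φ (μ.real Set.univ) fun f => ?_
    refine (norm_integral_le_of_norm_le_const (C := ‖f‖) (ae_of_all _ fun a => ?_)).trans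
      (le_of_eq (mul_comm _ _))
    rw [norm_mul, characterFun_apply, Circle.norm_coe, mul_one]
    exact f.norm_coe_le_norm a
  -- characters in `S` are orthogonal to `χ`
  have horth : ∀ ψ ∈ S, Φ (characterFun ψ) = 0 := by
    intro ψ hψ
    have hne : ψ * χ⁻¹ ≠ 1 := fun h => hχ (by rwa [← mul_inv_eq_one.mp h])
    obtain ⟨b, hb⟩ : ∃ b, (ψ * χ⁻¹) b ≠ 1 := by
      by_contra! h
      exact hne (ContinuousMonoidHom.ext h)
    have h1 : Φ (characterFun ψ) = ∫ a, (((ψ * χ⁻¹) a : Circle) : ℂ) ∂μ := rfl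
    have h2 := integral_mul_left_eq_self (μ := μ) (fun a => (((ψ * χ⁻¹) a : Circle) : ℂ)) b
    simp only [map_mul, Circle.coe_mul] at h2
    rw [integral_const_mul] at h2
    rw [h1]
    by_contra hI
    apply hb
    have := mul_right_cancel₀ hI (h2.trans (one_mul _).symm)
    exact Circle.ext (by simpa using this)
  let 𝒜 : StarSubalgebra ℂ C(G, ℂ) :=
    { toSubalgebra := Algebra.adjoin ℂ (characterFun '' (S : Set (G →ₜ* Circle)))
      star_mem' := by
        change Algebra.adjoin ℂ _ ≤ star (Algebra.adjoin ℂ _)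
        refine Algebra.adjoin_le ?_
        rintro _ ⟨ψ, hψ, rfl⟩
        refine Algebra.subset_adjoin ⟨ψ⁻¹, S.inv_mem hψ, ?_⟩
        ext a
        simp [characterFun_apply, coe_character_inv_apply] }
  have hspan : ∀ f ∈ 𝒜, Φ f = 0 := by
    intro f hf
    have h𝒜 : Subalgebra.toSubmodule 𝒜.toSubalgebra =
        Submodule.span ℂ (characterFun '' (S : Set (G →ₜ* Circle))) := by
      refine Algebra.adjoin_eq_span_of_subset ℂ (Set.Subset.trans ?_ Submodule.subset_span)
      intro x hx
      refine Submonoid.closure_induction (fun _ => id) ⟨1, S.one_mem, ?_⟩ ?_ hx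
      · ext a; simp [characterFun]
      · rintro _ _ - - ⟨ψ, hψ, rfl⟩ ⟨ψ', hψ', rfl⟩
        refine ⟨ψ * ψ', S.mul_mem hψ hψ', ?_⟩
        ext a; simp [characterFun]
    have hf' : f ∈ Submodule.span ℂ (characterFun '' (S : Set (G →ₜ* Circle))) := h𝒜 ▸ hf
    have hle : Submodule.span ℂ (characterFun '' (S : Set (G →ₜ* Circle))) ≤ LinearMap.ker Φ :=
      Submodule.span_le.mpr (by rintro _ ⟨ψ, hψ, rfl⟩; exact horth ψ hψ)
    exact hle hf'
  have hsep : 𝒜.SeparatesPoints := by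
    intro a b hab
    obtain ⟨ψ, hψ, hne⟩ : ∃ ψ ∈ S, ψ (a * b⁻¹) ≠ 1 := by
      by_contra! h
      exact hab (mul_inv_eq_one.mp (hS _ h))
    refine ⟨_, ⟨characterFun ψ, Algebra.subset_adjoin ⟨ψ, hψ, rfl⟩, rfl⟩, fun h => hne ?_⟩
    rw [map_mul, map_inv, mul_inv_eq_one]
    exact Circle.ext h
  have htop := ContinuousMap.starSubalgebra_topologicalClosure_eq_top_of_separatesPoints 𝒜 hsep
  have hmem : characterFun χ ∈ closure (𝒜 : Set C(G, ℂ)) := by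
    rw [← StarSubalgebra.topologicalClosure_coe, htop]
    trivial
  have hzero : Φ (characterFun χ) = 0 :=
    closure_minimal (fun f hf => hspan f hf) (isClosed_singleton.preimage hΦ_cont) hmem
  -- but `∫ χ χ̄ = μ(G) ≠ 0`
  have hone : Φ (characterFun χ) = ∫ _ : G, (1 : ℂ) ∂μ := by
    refine integral_congr_ae (ae_of_all _ fun a => ?_)
    simp [characterFun_apply, coe_character_inv_apply, Complex.mul_conj]
  rw [hone, integral_const] at hzero
  have : μ.real Set.univ ≠ 0 := by
    rw [Measure.real, ENNReal.toReal_ne_zero]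
    exact ⟨NeZero.ne _, measure_ne_top _ _⟩
  exact this (by simpa using hzero)

/-- A subtorus `Q` of a torus `G` is a retract of `G` by a continuous homomorphism, as the
coordinate characters of `Q` extend to `G`. -/
theorem IsTorus.exists_retraction (hG : IsTorus G) {Q : Subgroup G} (hQ : IsTorus Q) :
    ∃ r : G →ₜ* Q, ∀ q : Q, r (q : G) = q := by
  have := hQ.compactSpace
  obtain ⟨n, ⟨e⟩⟩ := hG
  obtain ⟨m, ⟨f⟩⟩ := hQ
  let ι : Q →ₜ* G := ⟨Q.subtype, continuous_subtype_val⟩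
  let S : Subgroup (Q →ₜ* Circle) :=
    { carrier := {χ | ∃ ψ : G →ₜ* Circle, ψ.comp ι = χ}
      mul_mem' := by rintro _ _ ⟨ψ, rfl⟩ ⟨ψ', rfl⟩; exact ⟨ψ * ψ', rfl⟩
      one_mem' := ⟨1, rfl⟩
      inv_mem' := by rintro _ ⟨ψ, rfl⟩; exact ⟨ψ⁻¹, rfl⟩ }
  have hS : ∀ a : Q, (∀ ψ ∈ S, ψ a = 1) → a = 1 := by
    intro a ha
    apply Subtype.ext
    apply e.injective
    rw [Subgroup.coe_one, map_one]
    ext1 i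
    exact ha _ ⟨⟨(Pi.evalMonoidHom (fun _ : Fin n => Circle) i).comp e.toMonoidHom,
      (continuous_apply i).comp e.continuous⟩, rfl⟩
  have hext : ∀ i, ∃ ψ : G →ₜ* Circle, ∀ q : Q, ψ (q : G) = f q i := fun i => by
    obtain ⟨ψ, hψ⟩ := mem_of_separatesPoints_characters S hS
      ⟨(Pi.evalMonoidHom (fun _ : Fin m => Circle) i).comp f.toMonoidHom,
        (continuous_apply i).comp f.continuous⟩
    exact ⟨ψ, fun q => DFunLike.congr_fun hψ q⟩
  choose ψ hψ using hext
  refine ⟨⟨(f.symm : (Fin m → Circle) →* Q).comp (MonoidHom.pi fun i => (ψ i : G →* Circle)),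
    f.symm.continuous.comp (continuous_pi fun i => map_continuous (ψ i))⟩, fun q => ?_⟩
  change f.symm (fun i => ψ i (q : G)) = q
  simp only [hψ]
  exact f.symm_apply_apply q

@[simp] theorem expAt_toQuotient (Q : Subgroup G) (ξ : LieAlg G) (t : ℝ) :
    (LieAlg.toQuotient Q ξ).expAt t = (ξ.expAt t : G ⧸ Q) := rfl

/-- One-parameter subgroups of `G ⧸ Q` lift to `G`: a retraction `r` of `G` onto `Q` gives the
continuous section `a Q ↦ a r(a)⁻¹` of the projection. -/
theorem IsTorus.toQuotient_surjective (hG : IsTorus G) {Q : Subgroup G} (hQ : IsTorus Q) :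
    Function.Surjective (LieAlg.toQuotient Q) := by
  obtain ⟨r, hr⟩ := hG.exists_retraction hQ
  let g : G →* G := MonoidHom.id G * (Q.subtype.comp (r : G →* Q))⁻¹
  have hg : ∀ a, g a = a * ((r a : Q) : G)⁻¹ := fun a => rfl
  let s : G ⧸ Q →* G := QuotientGroup.lift Q g fun q hq => by
    have := hr ⟨q, hq⟩
    rw [MonoidHom.mem_ker, hg, this]
    simp
  have hs_cont : Continuous s := by
    refine Continuous.quotient_lift (f := g) ?_ _
    change Continuous fun a => a * ((r a : Q) : G)⁻¹
    have := map_continuous r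
    fun_prop
  have hs : ∀ x, ((s x : G) : G ⧸ Q) = x := fun x => by
    induction x using QuotientGroup.induction_on with
    | H a =>
      change ((g a : G) : G ⧸ Q) = a
      rw [hg, QuotientGroup.eq]
      simp
  intro η
  refine ⟨LieAlg.mk' (fun t => s (η.expAt t)) (hs_cont.comp η.continuous_expAt) (by simp)
    (fun u v => by rw [LieAlg.expAt_add_right, map_mul]), LieAlg.ext fun t => ?_⟩
  simp [hs]

theorem toQuotient_eq_zero_iff {Q : Subgroup G} {ξ : LieAlg G} :
    LieAlg.toQuotient Q ξ = 0 ↔ ξ ∈ LieAlg.ofSubgroup Q := by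
  refine ⟨fun h t => ?_, fun h => LieAlg.ext fun t => ?_⟩
  · have := congrArg (fun η => LieAlg.expAt η t) h
    simpa using this
  · simpa using h t

end Characters

/-! ### Topological preliminaries -/

section General

variable {X Y : Type*} [TopologicalSpace X] [TopologicalSpace Y]

/-- A map into a compact space with closed graph is continuous. -/
theorem continuous_of_isClosed_graph [CompactSpace Y] {f : X → Y}
    (hf : IsClosed {z : X × Y | z.2 = f z.1}) : Continuous f := by
  rw [continuous_iff_isClosed]
  intro C hC
  convert isClosedMap_fst_of_compactSpace _ (hf.inter (hC.preimage continuous_snd)) using 1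
  ext x
  simp

/-- Preimages of preconnected sets under an open map with connected fibers are preconnected. -/
theorem isPreconnected_preimage_of_isOpenMap {f : X → Y} (hf : IsOpenMap f)
    (hsurj : Function.Surjective f)
    (hfib : ∀ y, IsPreconnected (f ⁻¹' {y})) {S : Set Y} (hS : IsPreconnected S) :
    IsPreconnected (f ⁻¹' S) := by
  rintro u v hu hv huv ⟨x, hxS, hxu⟩ ⟨y, hyS, hyv⟩
  obtain ⟨_, hzS, ⟨a, hau, rfl⟩, ⟨b, hbv, hab⟩⟩ := hS (f '' u) (f '' v) (hf u hu) (hf v hv)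
    (fun s hs => by
      obtain ⟨c, rfl⟩ := hsurj s
      exact (huv hs).imp (Set.mem_image_of_mem f) (Set.mem_image_of_mem f))
    ⟨f x, hxS, x, hxu, rfl⟩ ⟨f y, hyS, y, hyv, rfl⟩
  have hmem : ∀ c, f c = f a → c ∈ f ⁻¹' S := fun c hc => by rwa [Set.mem_preimage, hc]
  obtain ⟨c, hc, hcuv⟩ := hfib (f a) u v hu hv (fun c hc => huv (hmem c hc)) ⟨a, rfl, hau⟩
    ⟨b, hab, hbv⟩
  exact ⟨c, hmem c hc, hcuv⟩

end General

/-! ### The projection to the orbit space and actions through `Q` -/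

section Projection

variable {T : Type*} [CommGroup T] {M : Type*} [MulAction T M] {Q : Subgroup T}

theorem proj_eq_proj_iff {p p' : M} : proj Q p' = proj Q p ↔ ∃ q : Q, (q : T) • p = p' :=
  Quotient.eq''

theorem proj_smul_of_mem {a : T} (ha : a ∈ Q) (p : M) : proj Q (a • p) = proj Q p :=
  proj_eq_proj_iff.mpr ⟨⟨a, ha⟩, rfl⟩

theorem proj_surjective : Function.Surjective (proj Q : M → QuotientSpace Q M) :=
  Quotient.mk''_surjective

theorem preimage_proj_singleton (p : M) :
    proj Q ⁻¹' {proj Q p} = Set.range fun q : Q => (q : T) • p := by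
  ext p'
  exact proj_eq_proj_iff

variable (Q) in
/-- The subgroup of the elements of `T` that preserve the `Q`-orbit of every point of `P`. -/
def fiberStabilizer (P : Set M) : Subgroup T where
  carrier := {a | ∀ p ∈ P, proj Q (a • p) = proj Q p}
  mul_mem' {a b} ha hb p hp := by
    rw [← mk_smul_proj, QuotientGroup.mk_mul, mul_smul, mk_smul_proj, hb p hp, mk_smul_proj,
      ha p hp]
  one_mem' p _ := by rw [one_smul]
  inv_mem' {a} ha p hp := by
    rw [← mk_smul_proj, QuotientGroup.mk_inv, inv_smul_eq_iff, mk_smul_proj, ha p hp]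

/-- A homomorphism that realises the action of `K` through the free action of `Q` is determined
by its effect on a single point. -/
theorem ActsThrough.apply_eq_iff (hfree : ∀ a ∈ Q, ∀ p : M, a • p = p → a = 1) {K : Subgroup T}
    {ρ : K →* Q} {P : Set M} (hρ : ActsThrough ρ P) {p : M} (hp : p ∈ P) {a : K} {q : Q} :
    q = ρ a ↔ (q : T) • p = (a : T) • p := by
  refine ⟨fun h => h ▸ hρ a p hp, fun h => ?_⟩
  rw [← hρ a p hp, ← inv_smul_eq_iff, smul_smul] at h
  have := hfree _ (Q.mul_mem (Q.inv_mem (ρ a).2) q.2) p h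
  exact Subtype.ext (inv_mul_eq_one.mp this).symm

theorem ActsThrough.unique (hfree : ∀ a ∈ Q, ∀ p : M, a • p = p → a = 1) {K : Subgroup T}
    {ρ ρ' : K →* Q} {P : Set M} (hP : P.Nonempty) (hρ : ActsThrough ρ P)
    (hρ' : ActsThrough ρ' P) : ρ' = ρ := by
  obtain ⟨p, hp⟩ := hP
  ext1 a
  exact (hρ.apply_eq_iff hfree hp).mpr (hρ' a p hp)

theorem ActsThrough.apply_of_mem (hfree : ∀ a ∈ Q, ∀ p : M, a • p = p → a = 1) {K : Subgroup T}
    {ρ : K →* Q} {P : Set M} (hP : P.Nonempty) (hρ : ActsThrough ρ P) (a : K) (ha : (a : T) ∈ Q) :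
    ρ a = ⟨a, ha⟩ := by
  obtain ⟨p, hp⟩ := hP
  exact ((hρ.apply_eq_iff hfree hp).mpr rfl).symm

theorem mem_kernel_iff {K : Subgroup T} {ρ : K →* Q} {a : T} :
    a ∈ kernel ρ ↔ ∃ h : a ∈ K, ρ ⟨a, h⟩ = 1 := by
  simp [kernel, MonoidHom.mem_ker]

/-- The kernel of `ρ` is the stabilizer in `K` of each point of `P`. -/
theorem ActsThrough.mem_kernel_iff_smul_eq (hfree : ∀ a ∈ Q, ∀ p : M, a • p = p → a = 1)
    {K : Subgroup T} {ρ : K →* Q} {P : Set M} (hρ : ActsThrough ρ P) {p : M} (hp : p ∈ P)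
    {a : T} (ha : a ∈ K) : a ∈ kernel ρ ↔ a • p = p := by
  rw [mem_kernel_iff]
  have := hρ.apply_eq_iff hfree hp (a := ⟨a, ha⟩) (q := 1)
  rw [Subgroup.coe_one, one_smul] at this
  exact ⟨fun ⟨_, h⟩ => (this.mp h.symm).symm, fun h => ⟨ha, (this.mpr h.symm).symm⟩⟩

theorem ActsThrough.mono {K : Subgroup T} {ρ : K →* Q} {P P' : Set M} (hρ : ActsThrough ρ P')
    (h : P ⊆ P') : ActsThrough ρ P := fun a p hp => hρ a p (h hp)

variable [TopologicalSpace M]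

theorem continuous_proj : Continuous (proj Q : M → QuotientSpace Q M) := continuous_quot_mk

theorem subset_preimage_closure_image_proj (S : Set M) :
    S ⊆ proj Q ⁻¹' closure (proj Q '' S) := fun p hp => subset_closure ⟨p, hp, rfl⟩

variable [TopologicalSpace T] [ContinuousSMul T M]

theorem isOpenMap_proj : IsOpenMap (proj Q : M → QuotientSpace Q M) :=
  isOpenMap_quotient_mk'_mul

theorem isPreconnected_preimage_proj [PreconnectedSpace Q] {S : Set (QuotientSpace Q M)}
    (hS : IsPreconnected S) : IsPreconnected (proj Q ⁻¹' S) := by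
  refine isPreconnected_preimage_of_isOpenMap isOpenMap_proj proj_surjective (fun x => ?_) hS
  obtain ⟨p, rfl⟩ := proj_surjective x
  rw [preimage_proj_singleton]
  exact isPreconnected_range (by fun_prop)

variable [T2Space M]

theorem ActsThrough.closure {K : Subgroup T} {ρ : K →* Q} {P : Set M} (hρ : ActsThrough ρ P) :
    ActsThrough ρ (closure P) := fun a =>
  closure_minimal (fun p hp => hρ a p hp) (isClosed_eq (by fun_prop) (by fun_prop))

theorem isClosed_fiberStabilizer [CompactSpace Q] (P : Set M) :
    IsClosed (fiberStabilizer Q P : Set T) := by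
  have : (fiberStabilizer Q P : Set T) =
      ⋂ p ∈ P, (fun a : T => a • p) ⁻¹' Set.range fun q : Q => (q : T) • p := by
    ext a
    simp only [Set.mem_iInter, ← preimage_proj_singleton]
    rfl
  rw [this]
  refine isClosed_biInter fun p _ => IsClosed.preimage (by fun_prop) ?_
  exact (isCompact_range (by fun_prop)).isClosed

/-- As `Q` is compact and acts freely, the element of `Q` that moves `g x` to `h x` depends
continuously on `x`. -/
theorem continuous_of_smul_eq [CompactSpace Q] (hfree : ∀ a ∈ Q, ∀ p : M, a • p = p → a = 1)
    {X : Type*} [TopologicalSpace X] {g h : X → M} (hg : Continuous g) (hh : Continuous h)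
    {r : X → Q} (hr : ∀ x, (r x : T) • g x = h x) : Continuous r := by
  refine continuous_of_isClosed_graph ?_
  have : {z : X × Q | z.2 = r z.1} = {z | (z.2 : T) • g z.1 = h z.1} := by
    ext ⟨x, q⟩
    refine ⟨fun hq => ?_, fun hq => ?_⟩
    · have hq' : q = r x := hq
      rw [Set.mem_ofPred_eq, hq']
      exact hr x
    · have hq' : (q : T) • g x = h x := hq
      rw [← hr x, ← inv_smul_eq_iff, smul_smul] at hq'
      have := hfree _ (Q.mul_mem (Q.inv_mem (r x).2) q.2) _ hq'
      exact Subtype.ext (inv_mul_eq_one.mp this).symm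
  rw [this]
  exact isClosed_eq (by fun_prop) (by fun_prop)

theorem ActsThrough.continuous [CompactSpace Q]
    (hfree : ∀ a ∈ Q, ∀ p : M, a • p = p → a = 1) {K : Subgroup T} {ρ : K →* Q} {P : Set M}
    (hP : P.Nonempty) (hρ : ActsThrough ρ P) : Continuous ρ := by
  obtain ⟨p, hp⟩ := hP
  exact continuous_of_smul_eq hfree (g := fun _ => p) (h := fun a : K => (a : T) • p)
    (by fun_prop) (by fun_prop) fun a => hρ a p hp

/-- On a preconnected set `P` the group preserving the `Q`-orbits of its points acts through a
single homomorphism to `Q`. For each point there is such a homomorphism since `Q` acts freely; it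
depends continuously on the point, uniformly on the compact group, so it is locally constant
because `Q` has no small subgroups. -/
theorem exists_actsThrough_fiberStabilizer [IsTopologicalGroup T] [CompactSpace T] (hQ : IsTorus Q)
    (hfree : ∀ a ∈ Q, ∀ p : M, a • p = p → a = 1) {P : Set M} (hP : IsPreconnected P)
    (hne : P.Nonempty) : ∃ ρ : fiberStabilizer Q P →* Q, ActsThrough ρ P := by
  have := hQ.compactSpace
  have := isCompact_iff_compactSpace.mp (isClosed_fiberStabilizer (Q := Q) P).isCompact
  have := Subtype.preconnectedSpace hP
  have hex : ∀ (p : P) (a : fiberStabilizer Q P), ∃ q : Q, (q : T) • (p : M) = (a : T) • (p : M) :=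
    fun p a => proj_eq_proj_iff.mp (a.2 p p.2)
  choose r hr using hex
  have hr_cont : Continuous fun z : P × fiberStabilizer Q P => r z.1 z.2 :=
    continuous_of_smul_eq hfree (g := fun z : P × fiberStabilizer Q P => (z.1 : M))
      (h := fun z => (z.2 : T) • (z.1 : M)) (by fun_prop) (by fun_prop) fun z => hr z.1 z.2
  have heq : ∀ (p : P) (q q' : Q), (q : T) • (p : M) = (q' : T) • (p : M) → q = q' :=
    fun p q q' h => by
      rw [← inv_smul_eq_iff, smul_smul] at h
      exact Subtype.ext (inv_mul_eq_one.mp (hfree _ (Q.mul_mem (Q.inv_mem q'.2) q.2) _ h)).symm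
  let ρ : P → fiberStabilizer Q P →* Q := fun p => MonoidHom.mk' (r p) fun a b => heq p _ _ (by
    rw [hr, Subgroup.coe_mul, Subgroup.coe_mul, mul_smul, mul_smul, hr p b,
      smul_comm (r p a : T), hr p a, smul_comm])
  have hρ : ∀ p a, ρ p a = r p a := fun _ _ => rfl
  have hloc : IsLocallyConstant ρ := by
    rw [IsLocallyConstant.iff_exists_open]
    intro p₀
    obtain ⟨U, hU, hU1, hUbot⟩ := hQ.exists_open_forall_subgroup_eq_bot
    let W : Set (P × fiberStabilizer Q P) := {z | r z.1 z.2 * (r p₀ z.2)⁻¹ ∈ U}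
    have hW : IsOpen W := hU.preimage (hr_cont.mul
      (hr_cont.comp (f := fun z : P × fiberStabilizer Q P => (p₀, z.2)) (by fun_prop)).inv)
    obtain ⟨V, V', hV, -, hpV, hV', hVW⟩ := generalized_tube_lemma (isCompact_singleton (x := p₀))
      isCompact_univ hW (by
        rintro ⟨p, a⟩ ⟨hp, -⟩
        obtain rfl : p = p₀ := hp
        change r p a * (r p a)⁻¹ ∈ U
        rwa [mul_inv_cancel])
    refine ⟨V, hV, hpV rfl, fun p hp => ?_⟩
    -- the image of the homomorphism `ρ p / ρ p₀` is a subgroup contained in `U`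
    have hbot := hUbot (ρ p * (ρ p₀)⁻¹).range (by
      rintro _ ⟨a, rfl⟩
      exact hVW (Set.mk_mem_prod hp (hV' (Set.mem_univ a))))
    rw [MonoidHom.range_eq_bot_iff] at hbot
    exact mul_inv_eq_one.mp hbot
  obtain ⟨p₀, hp₀⟩ := hne
  refine ⟨ρ ⟨p₀, hp₀⟩, fun a p hp => ?_⟩
  rw [hloc.apply_eq_of_preconnectedSpace ⟨p₀, hp₀⟩ ⟨p, hp⟩]
  exact hr ⟨p, hp⟩ a

end Projection

/-! ### Infinitesimal stabilizers in `M` and in `M/Q` -/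

section InfinitesimalStabilizers

variable {T : Type*} [CommGroup T] [TopologicalSpace T] [IsTopologicalGroup T]
  {M : Type*} [MulAction T M] {Q : Subgroup T}

theorem mem_infStab {p : M} {ξ : LieAlg T} : ξ ∈ infStab p ↔ ∀ t, ξ.expAt t • p = p := Iff.rfl

theorem mem_infStabOn {S : Set M} {ξ : LieAlg T} :
    ξ ∈ infStabOn S ↔ ∀ p ∈ S, ∀ t, ξ.expAt t • p = p := by
  simp [infStabOn, Submodule.mem_iInf, mem_infStab]

theorem mem_fiberLie {S : Set (QuotientSpace Q M)} {ξ : LieAlg T} :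
    ξ ∈ fiberLie Q S ↔ ∀ p : M, proj Q p ∈ S → ∀ t, proj Q (ξ.expAt t • p) = proj Q p := by
  rw [fiberLie, Submodule.mem_comap, mem_infStabOn]
  refine ⟨fun h p hp t => h _ hp t, fun h x hx t => ?_⟩
  obtain ⟨p, rfl⟩ := proj_surjective x
  exact h p hx t

theorem ofSubgroup_le_fiberLie (S : Set (QuotientSpace Q M)) :
    LieAlg.ofSubgroup Q ≤ fiberLie Q S := fun _ hξ =>
  mem_fiberLie.mpr fun p _ t => proj_smul_of_mem (hξ t) p

theorem expAt_mem_expSubgroup {h : Submodule ℝ (LieAlg T)} {ξ : LieAlg T} (hξ : ξ ∈ h) (t : ℝ) :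
    ξ.expAt t ∈ LieAlg.expSubgroup h :=
  ⟨t • ξ, h.smul_mem t hξ, by simp⟩

theorem fiberTorus_le_fiberStabilizer (S : Set (QuotientSpace Q M)) :
    fiberTorus Q S ≤ fiberStabilizer Q (proj Q ⁻¹' S) := by
  rintro _ ⟨ξ, hξ, rfl⟩ p hp
  exact mem_fiberLie.mp hξ p hp 1

theorem le_fiberTorus (hQ : IsTorus Q) (S : Set (QuotientSpace Q M)) : Q ≤ fiberTorus Q S := by
  intro a ha
  obtain ⟨ξ, hξ⟩ := hQ.exists_expAt_one_eq ⟨a, ha⟩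
  refine ⟨LieAlg.mk' (fun t => (ξ.expAt t : T)) (continuous_subtype_val.comp ξ.continuous_expAt)
    (by simp) (fun s t => by simp [LieAlg.expAt_add_right]), ?_, ?_⟩
  · exact ofSubgroup_le_fiberLie S fun t => (ξ.expAt t).2
  · simp [hξ]

theorem ActsThrough.surjective (hQ : IsTorus Q)
    (hfree : ∀ a ∈ Q, ∀ p : M, a • p = p → a = 1) {S : Set (QuotientSpace Q M)}
    {ρ : fiberTorus Q S →* Q} {P : Set M} (hP : P.Nonempty) (hρ : ActsThrough ρ P) :
    Function.Surjective ρ := fun q =>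
  ⟨⟨q, le_fiberTorus hQ S q.2⟩, hρ.apply_of_mem hfree hP _ q.2⟩

/-- The Lie algebra of `exp 𝔨` is `𝔨` when `𝔨 = fiberLie Q S`: the elements of `exp 𝔨` stabilize
the points of `S`, and `𝔨` consists of all `ξ` for which every `exp (t ξ)` does so. -/
theorem ofSubgroup_fiberTorus (S : Set (QuotientSpace Q M)) :
    LieAlg.ofSubgroup (fiberTorus Q S) = fiberLie Q S :=
  le_antisymm
    (fun _ hξ => mem_fiberLie.mpr fun p hp t => fiberTorus_le_fiberStabilizer S (hξ t) p hp)
    fun _ hξ t => expAt_mem_expSubgroup hξ t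

theorem disjoint_infStab_ofSubgroup (hfree : ∀ a ∈ Q, ∀ p : M, a • p = p → a = 1) (p : M) :
    Disjoint (infStab p) (LieAlg.ofSubgroup Q) :=
  Submodule.disjoint_def.mpr fun _ hξ hξQ => LieAlg.ext fun t => hfree _ (hξQ t) p (hξ t)

theorem injOn_toQuotient {h : Submodule ℝ (LieAlg T)} (hd : Disjoint h (LieAlg.ofSubgroup Q)) :
    Set.InjOn (LieAlg.toQuotient Q) h := fun ξ hξ η hη heq => by
  rw [← sub_eq_zero, ← map_sub, toQuotient_eq_zero_iff] at heq
  exact sub_eq_zero.mp (Submodule.disjoint_def.mp hd _ (h.sub_mem hξ hη) heq)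

/-- Let `exp 𝔨` act on `P` through a homomorphism `ρ` to `Q`. The Lie algebra of `ker ρ` is the
infinitesimal stabilizer of every `p ∈ P` such that all one-parameter groups preserving the orbit
`Q p` are generated by elements of `𝔨`; in particular it is the same for all these `p`. -/
theorem ActsThrough.ofSubgroup_kernel_eq_infStab
    (hfree : ∀ a ∈ Q, ∀ p : M, a • p = p → a = 1) {S : Set (QuotientSpace Q M)}
    {ρ : fiberTorus Q S →* Q} {P : Set M} (hρ : ActsThrough ρ P) {p : M} (hp : p ∈ P)
    (hpS : fiberLie Q {proj Q p} ≤ fiberLie Q S) :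
    LieAlg.ofSubgroup (kernel ρ) = infStab p := by
  ext ξ
  refine ⟨fun hξ t => ?_, fun hξ t => ?_⟩
  · obtain ⟨h, -⟩ := mem_kernel_iff.mp (hξ t)
    exact (hρ.mem_kernel_iff_smul_eq hfree hp h).mp (hξ t)
  · have hmem : ξ ∈ fiberLie Q {proj Q p} := by
      refine mem_fiberLie.mpr fun p' hp' t => ?_
      have hp' : proj Q p' = proj Q p := hp'
      rw [← mk_smul_proj, hp', mk_smul_proj, hξ t]
    exact (hρ.mem_kernel_iff_smul_eq hfree hp (expAt_mem_expSubgroup (hpS hmem) t)).mpr (hξ t)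

variable [TopologicalSpace M]

theorem Stratum.fiberLie_singleton_eq (X : Stratum (T ⧸ Q) (QuotientSpace Q M))
    {x : QuotientSpace Q M} (hx : x ∈ X.carrier) : fiberLie Q {x} = fiberLie Q X.carrier := by
  rw [fiberLie, fiberLie, show infStabOn X.carrier = X.lie from rfl, ← X.infStab_eq hx]
  simp [infStabOn]

variable [T2Space M] [ContinuousSMul T M]

/-- The infinitesimal stabilizer of `proj Q p`, pulled back to the Lie algebra of `T`, is the
direct sum of that of `p` and the Lie algebra of `Q`: a one-parameter group that preserves the
`Q`-orbit of `p` acts on `p` through a one-parameter group in `Q`. -/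
theorem fiberLie_singleton (hQ : IsTorus Q) (hfree : ∀ a ∈ Q, ∀ p : M, a • p = p → a = 1)
    (p : M) : fiberLie Q {proj Q p} = infStab p ⊔ LieAlg.ofSubgroup Q := by
  have := hQ.compactSpace
  refine le_antisymm (fun ξ hξ => ?_) (sup_le (fun ξ hξ => ?_) (ofSubgroup_le_fiberLie _))
  · have hex : ∀ t, ∃ q : Q, (q : T) • p = ξ.expAt t • p := fun t =>
      proj_eq_proj_iff.mp (mem_fiberLie.mp hξ p rfl t)
    choose r hr using hex
    have hcont : Continuous r := by
      have := ξ.continuous_expAt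
      exact continuous_of_smul_eq hfree (g := fun _ => p) (h := fun t : ℝ => ξ.expAt t • p)
        (by fun_prop) (by fun_prop) hr
    have heq : ∀ q q' : T, q ∈ Q → q' ∈ Q → q • p = q' • p → q = q' := fun q q' hq hq' h => by
      rw [← inv_smul_eq_iff, smul_smul] at h
      exact (inv_mul_eq_one.mp (hfree _ (Q.mul_mem (Q.inv_mem hq') hq) _ h)).symm
    let η : LieAlg T := LieAlg.mk' (fun t => (r t : T)) (by fun_prop)
      (heq _ _ (r 0).2 Q.one_mem (by rw [hr, LieAlg.expAt_zero_right]))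
      (fun s t => heq _ _ (r _).2 (Q.mul_mem (r s).2 (r t).2) (by
        rw [hr, LieAlg.expAt_add_right, mul_smul, mul_smul, hr t, smul_comm (r s : T), hr s,
          smul_comm]))
    have hη : η ∈ LieAlg.ofSubgroup Q := fun t => (r t).2
    refine Submodule.mem_sup.mpr ⟨ξ - η, fun t => ?_, η, hη, sub_add_cancel ξ η⟩
    rw [sub_eq_add_neg, add_comm, LieAlg.expAt_add, LieAlg.expAt_neg, MulAction.mem_stabilizer_iff,
      mul_smul, inv_smul_eq_iff]
    exact (hr t).symm
  · refine mem_fiberLie.mpr fun p' hp' t => ?_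
    have hp' : proj Q p' = proj Q p := hp'
    rw [← mk_smul_proj, hp', mk_smul_proj, hξ t]

theorem infStab_proj (hT : IsTorus T) (hQ : IsTorus Q)
    (hfree : ∀ a ∈ Q, ∀ p : M, a • p = p → a = 1) (p : M) :
    infStab (proj Q p) = (infStab p).map (LieAlg.toQuotient Q) := by
  have h1 : infStab (proj Q p) = (fiberLie Q {proj Q p}).map (LieAlg.toQuotient Q) := by
    rw [fiberLie, Submodule.map_comap_eq_of_surjective (hT.toQuotient_surjective hQ)]
    simp [infStabOn]
  have h2 : (LieAlg.ofSubgroup Q).map (LieAlg.toQuotient Q) = ⊥ := by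
    rw [← le_bot_iff, Submodule.map_le_iff_le_comap]
    exact fun ξ hξ => toQuotient_eq_zero_iff.mpr hξ
  rw [h1, fiberLie_singleton hQ hfree, Submodule.map_sup, h2, sup_bot_eq]

end InfinitesimalStabilizers

/-! ### Infinitesimal strata -/

section Strata

variable {G : Type*} [CommGroup G] [TopologicalSpace G] [IsTopologicalGroup G]
  {N : Type*} [MulAction G N] [TopologicalSpace N]

theorem Stratum.ext_carrier {X Y : Stratum G N} (h : X.carrier = Y.carrier) : X = Y := by
  cases X
  cases Y
  cases h
  rfl

variable (G) in
/-- The infinitesimal stratum through the point `p`. -/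
def stratumAt (p : N) : Stratum G N where
  carrier := connectedComponentIn {q | infStab q = (infStab p : Submodule ℝ (LieAlg G))} p
  exists_eq := ⟨_, p, rfl, rfl⟩

theorem mem_stratumAt (p : N) : p ∈ (stratumAt G p).carrier :=
  mem_connectedComponentIn rfl

theorem Stratum.exists_eq_stratumAt (X : Stratum G N) : ∃ p, X = stratumAt G p := by
  obtain ⟨_, p, rfl, hX⟩ := X.exists_eq
  exact ⟨p, Stratum.ext_carrier hX⟩

theorem Stratum.isPreconnected (X : Stratum G N) : IsPreconnected X.carrier := by
  obtain ⟨p, rfl⟩ := X.exists_eq_stratumAt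
  exact isPreconnected_connectedComponentIn

theorem Stratum.nonempty (X : Stratum G N) : X.carrier.Nonempty := by
  obtain ⟨p, rfl⟩ := X.exists_eq_stratumAt
  exact ⟨p, mem_stratumAt p⟩

end Strata

/-! ### Strata of `M` and of `M/Q` -/

section StrataCorrespondence

variable {T : Type*} [CommGroup T] [TopologicalSpace T] [IsTopologicalGroup T]
  {M : Type*} [TopologicalSpace M] [T2Space M] [MulAction T M] [ContinuousSMul T M]
  {Q : Subgroup T}

/-- The action of `K = exp 𝔨` on the closure of the preimage of a stratum with infinitesimal
stabilizer `𝔨/𝔮` is given by a homomorphism to `Q`. -/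
theorem exists_actsThrough (hT : IsTorus T) (hQ : IsTorus Q)
    (hfree : ∀ a ∈ Q, ∀ p : M, a • p = p → a = 1)
    (X : Stratum (T ⧸ Q) (QuotientSpace Q M)) :
    ∃ ρ : fiberTorus Q X.carrier →* Q, ActsThrough ρ (proj Q ⁻¹' closure X.carrier) := by
  have := hT.compactSpace
  have := hQ.preconnectedSpace
  obtain ⟨ρ, hρ⟩ := exists_actsThrough_fiberStabilizer hQ hfree
    (isPreconnected_preimage_proj X.isPreconnected) (X.nonempty.preimage proj_surjective)
  refine ⟨ρ.comp (Subgroup.inclusion (fiberTorus_le_fiberStabilizer X.carrier)), ?_⟩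
  rw [isOpenMap_proj.preimage_closure_eq_closure_preimage continuous_proj]
  exact fun a p hp => hρ.closure (Subgroup.inclusion (fiberTorus_le_fiberStabilizer _) a) p hp

/-- The preimage of the stratum through `proj Q p` is the stratum through `p`. -/
theorem preimage_stratumAt_proj (hT : IsTorus T) (hQ : IsTorus Q)
    (hfree : ∀ a ∈ Q, ∀ p : M, a • p = p → a = 1) (p : M) :
    proj Q ⁻¹' (stratumAt (T ⧸ Q) (proj Q p)).carrier = (stratumAt T p).carrier := by
  have := hQ.preconnectedSpace
  set X := stratumAt (T ⧸ Q) (proj Q p) with hX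
  have hpX : proj Q p ∈ X.carrier := mem_stratumAt _
  apply Set.Subset.antisymm
  · obtain ⟨ρ, hρ⟩ := exists_actsThrough hT hQ hfree X
    refine (isPreconnected_preimage_proj X.isPreconnected).subset_connectedComponentIn hpX
      fun q hq => ?_
    change infStab q = infStab p
    rw [← hρ.ofSubgroup_kernel_eq_infStab hfree (subset_closure hq)
        (X.fiberLie_singleton_eq hq).le,
      ← hρ.ofSubgroup_kernel_eq_infStab hfree (subset_closure hpX)
        (X.fiberLie_singleton_eq hpX).le]
  · rw [← Set.image_subset_iff]
    refine ((stratumAt T p).isPreconnected.image _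
      continuous_proj.continuousOn).subset_connectedComponentIn ⟨p, mem_stratumAt p, rfl⟩ ?_
    rintro _ ⟨q, hq, rfl⟩
    change infStab (proj Q q) = infStab (proj Q p)
    rw [infStab_proj hT hQ hfree, infStab_proj hT hQ hfree, (stratumAt T p).infStab_eq hq,
      (stratumAt T p).infStab_eq (mem_stratumAt p)]

end StrataCorrespondence

/-! ### Homogeneous polynomials -/

section Polynomials

/-- Linear maps pull homogeneous polynomials back to homogeneous polynomials. -/
theorem comp_mem_homogeneousPoly {V W : Type*} [AddCommGroup V] [Module ℝ V] [AddCommGroup W]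
    [Module ℝ W] (f : V →ₗ[ℝ] W) {k : ℕ} {P : W → ℝ} (hP : P ∈ homogeneousPoly W k) :
    P ∘ f ∈ homogeneousPoly V k := by
  let F : (W → ℝ) →ₐ[ℝ] (V → ℝ) :=
    AlgHom.pi fun v => Pi.evalAlgHom ℝ (fun _ : W => ℝ) (f v)
  have h1 : F P ∈ (homogeneousPoly W k).map F.toLinearMap := Submodule.mem_map_of_mem hP
  rw [homogeneousPoly, Submodule.map_pow] at h1
  refine pow_le_pow_left' (Submodule.map_le_iff_le_comap.mpr ?_) k h1
  rintro _ ⟨l, rfl⟩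
  exact ⟨l ∘ₗ f, rfl⟩

end Polynomials

/-! ### Assignments -/

section Assignments

variable {G : Type*} [CommGroup G] [TopologicalSpace G] [IsTopologicalGroup G]
  {N : Type*} [MulAction G N] [TopologicalSpace N]

theorem mem_assignmentRing {A : StratumFun G N} :
    A ∈ assignmentRing G N ↔ A ∈ ⨆ k, assignments G N k := Iff.rfl

/-- The compatibility condition along `X ≼ Y` holds for all elements of the ring of assignments,
not only for the homogeneous ones. -/
theorem apply_eq_of_mem_assignmentRing {A : StratumFun G N} (hA : A ∈ assignmentRing G N)
    {X Y : Stratum G N} (hXY : X ≤ Y) {ξ : LieAlg G} (hY : ξ ∈ Y.lie) (hX : ξ ∈ X.lie) :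
    A Y ⟨ξ, hY⟩ = A X ⟨ξ, hX⟩ := by
  rw [mem_assignmentRing] at hA
  induction hA using Submodule.iSup_induction' with
  | mem k A hA => exact hA.2 X Y hXY ξ hY hX
  | zero => rfl
  | add A B _ _ hA hB => exact congrArg₂ (· + ·) hA hB

theorem Stratum.mem_lie {Y : Stratum G N} {ξ : LieAlg G} :
    ξ ∈ Y.lie ↔ ∀ p ∈ Y.carrier, ∀ t, ξ.expAt t • p = p :=
  mem_infStabOn

theorem Stratum.disjoint_lie {Q : Subgroup G} (hfree : ∀ a ∈ Q, ∀ p : N, a • p = p → a = 1)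
    (X : Stratum G N) : Disjoint X.lie (LieAlg.ofSubgroup Q) := by
  obtain ⟨p, hp⟩ := X.nonempty
  rw [← X.infStab_eq hp]
  exact disjoint_infStab_ofSubgroup hfree p

/-- Infinitesimal stabilizers increase when passing to the closure of a stratum. -/
theorem Stratum.lie_le_lie [T2Space N] [ContinuousConstSMul G N] {X Y : Stratum G N}
    (h : X ≤ Y) : Y.lie ≤ X.lie := fun _ hξ => Stratum.mem_lie.mpr fun _ hp t =>
  closure_minimal (t := {p : N | _ • p = p}) (fun q hq => Stratum.mem_lie.mp hξ q hq t)
    (isClosed_eq (continuous_const_smul _) continuous_id) (h hp)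

end Assignments

/-! ### The isomorphism of rings of assignments -/

section StrataEquivalence

variable {T : Type*} [CommGroup T] [TopologicalSpace T] [IsTopologicalGroup T]
  {M : Type*} [TopologicalSpace M] [T2Space M] [MulAction T M] [ContinuousSMul T M]
  {Q : Subgroup T} (hT : IsTorus T) (hQ : IsTorus Q)
  (hfree : ∀ a ∈ Q, ∀ p : M, a • p = p → a = 1)

theorem image_stratumAt (hT : IsTorus T) (hQ : IsTorus Q)
    (hfree : ∀ a ∈ Q, ∀ p : M, a • p = p → a = 1) (p : M) :
    proj Q '' (stratumAt T p).carrier = (stratumAt (T ⧸ Q) (proj Q p)).carrier := by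
  rw [← preimage_stratumAt_proj hT hQ hfree, Set.image_preimage_eq _ proj_surjective]

/-- The image in `M/Q` of an infinitesimal stratum of `M`. -/
def Stratum.image (X : Stratum T M) : Stratum (T ⧸ Q) (QuotientSpace Q M) where
  carrier := proj Q '' X.carrier
  exists_eq := by
    obtain ⟨p, rfl⟩ := X.exists_eq_stratumAt
    exact ⟨_, proj Q p, rfl, image_stratumAt hT hQ hfree p⟩

theorem Stratum.image_carrier (X : Stratum T M) :
    (X.image hT hQ hfree).carrier = proj Q '' X.carrier := rfl

theorem Stratum.preimage_image (X : Stratum T M) :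
    proj Q ⁻¹' (X.image hT hQ hfree).carrier = X.carrier := by
  obtain ⟨p, rfl⟩ := X.exists_eq_stratumAt
  rw [Stratum.image_carrier, image_stratumAt hT hQ hfree, preimage_stratumAt_proj hT hQ hfree]

theorem Stratum.image_injective :
    Function.Injective (Stratum.image hT hQ hfree : Stratum T M → _) := fun X Y h =>
  Stratum.ext_carrier (by
    rw [← X.preimage_image hT hQ hfree, h, Y.preimage_image hT hQ hfree])

theorem Stratum.image_surjective :
    Function.Surjective (Stratum.image hT hQ hfree : Stratum T M → _) := fun Y => by
  obtain ⟨x, rfl⟩ := Y.exists_eq_stratumAt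
  obtain ⟨p, rfl⟩ := proj_surjective x
  exact ⟨stratumAt T p, Stratum.ext_carrier (image_stratumAt hT hQ hfree p)⟩

theorem Stratum.image_le_image_iff {X Y : Stratum T M} :
    X.image hT hQ hfree ≤ Y.image hT hQ hfree ↔ X ≤ Y := by
  change proj Q '' X.carrier ⊆ closure _ ↔ X.carrier ⊆ closure Y.carrier
  rw [Set.image_subset_iff,
    isOpenMap_proj.preimage_closure_eq_closure_preimage continuous_proj, Y.preimage_image]

theorem Stratum.lie_image (X : Stratum T M) :
    (X.image hT hQ hfree).lie = X.lie.map (LieAlg.toQuotient Q) := by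
  obtain ⟨p, hp⟩ := X.nonempty
  rw [← X.infStab_eq hp, ← infStab_proj hT hQ hfree, Stratum.infStab_eq]
  exact ⟨p, hp, rfl⟩

theorem Stratum.bijOn_lie_image (X : Stratum T M) :
    Set.BijOn (LieAlg.toQuotient Q) X.lie (X.image hT hQ hfree).lie := by
  rw [X.lie_image]
  exact (injOn_toQuotient (X.disjoint_lie hfree)).bijOn_image

/-- The isomorphism `ξ ↦ ξ + 𝔮` between the infinitesimal stabilizers of a stratum and of its
image. -/
noncomputable def Stratum.lieEquiv (X : Stratum T M) : X.lie ≃ₗ[ℝ] (X.image hT hQ hfree).lie :=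
  LinearEquiv.ofBijective
    ((LieAlg.toQuotient Q).restrict fun _ hξ => (X.bijOn_lie_image hT hQ hfree).mapsTo hξ)
    ((X.bijOn_lie_image hT hQ hfree).bijective)

/-- The pullback of functions on strata from `M/Q` to `M`: the value at `X` is that at the image
of `X`, pulled back along `ξ ↦ ξ + 𝔮`. -/
noncomputable def stratumFunPullback :
    StratumFun (T ⧸ Q) (QuotientSpace Q M) ≃ₐ[ℝ] StratumFun T M :=
  AlgEquiv.ofBijective
    { toFun := fun B X ξ => B (X.image hT hQ hfree) (X.lieEquiv hT hQ hfree ξ)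
      map_one' := rfl
      map_mul' := fun _ _ => rfl
      map_zero' := rfl
      map_add' := fun _ _ => rfl
      commutes' := fun _ => rfl }
    ⟨fun B B' h => by
      funext Y η
      obtain ⟨X, rfl⟩ := Stratum.image_surjective hT hQ hfree Y
      obtain ⟨ξ, rfl⟩ := (X.lieEquiv hT hQ hfree).surjective η
      exact congrFun (congrFun h X) ξ,
    fun A => by
      -- the value of the preimage of `A` at a stratum `Y` of `M/Q` is built on a chosen stratum
      -- `pre Y` of `M` with image `Y`
      choose pre hpre using Stratum.image_surjective hT hQ hfree
      have key : ∀ (X : Stratum T M) (Y) (h : X.image hT hQ hfree = Y),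
          ∃ g : Y.lie → ℝ, ∀ ξ : X.lie, ∀ hξ, g ⟨LieAlg.toQuotient Q ξ, hξ⟩ = A X ξ := by
        rintro X _ rfl
        refine ⟨fun η => A X ((X.lieEquiv hT hQ hfree).symm η), fun ξ hξ => ?_⟩
        refine congrArg (A X) ?_
        exact (X.lieEquiv hT hQ hfree).symm_apply_apply ξ
      choose g hg using fun Y => key (pre Y) Y (hpre Y)
      refine ⟨g, ?_⟩
      funext X ξ
      have hX : pre (X.image hT hQ hfree) = X := Stratum.image_injective hT hQ hfree (hpre _)
      have := hg (X.image hT hQ hfree) ⟨ξ, hX.symm ▸ ξ.2⟩ (X.lieEquiv hT hQ hfree ξ).2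
      refine this.trans ?_
      have hgen : ∀ (X' : Stratum T M) (_ : X' = X) (h' : (ξ : LieAlg T) ∈ X'.lie),
          A X' ⟨ξ, h'⟩ = A X ξ := by
        rintro _ rfl _
        rfl
      exact hgen _ hX _⟩

theorem stratumFunPullback_apply (B : StratumFun (T ⧸ Q) (QuotientSpace Q M)) (X : Stratum T M)
    (ξ : X.lie) : stratumFunPullback hT hQ hfree B X ξ =
      B (X.image hT hQ hfree) (X.lieEquiv hT hQ hfree ξ) := rfl

theorem stratumFunPullback_mem_assignments_iff {k : ℕ}
    {B : StratumFun (T ⧸ Q) (QuotientSpace Q M)} :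
    stratumFunPullback hT hQ hfree B ∈ assignments T M k ↔
      B ∈ assignments (T ⧸ Q) (QuotientSpace Q M) k := by
  refine ⟨fun h => ⟨fun Y => ?_, fun Y Y' hYY' η hY' hY => ?_⟩, fun h => ⟨fun X => ?_,
    fun X X' hXX' ξ hX' hX => ?_⟩⟩
  · obtain ⟨X, rfl⟩ := Stratum.image_surjective hT hQ hfree Y
    convert comp_mem_homogeneousPoly (X.lieEquiv hT hQ hfree).symm.toLinearMap (h.1 X) using 1
    funext η
    simp [stratumFunPullback_apply]
  · obtain ⟨X, rfl⟩ := Stratum.image_surjective hT hQ hfree Y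
    obtain ⟨X', rfl⟩ := Stratum.image_surjective hT hQ hfree Y'
    have hXX' := (Stratum.image_le_image_iff hT hQ hfree).mp hYY'
    obtain ⟨ξ, hξ, rfl⟩ := (X'.bijOn_lie_image hT hQ hfree).surjOn hY'
    exact h.2 X X' hXX' ξ hξ (Stratum.lie_le_lie hXX' hξ)
  · exact comp_mem_homogeneousPoly (X.lieEquiv hT hQ hfree).toLinearMap (h.1 _)
  · exact h.2 _ _ ((Stratum.image_le_image_iff hT hQ hfree).mpr hXX') _ _ _

/-- The pullback from `M/Q` to `M` restricts to an isomorphism of rings of assignments. -/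
theorem map_stratumFunPullback_assignmentRing :
    (assignmentRing (T ⧸ Q) (QuotientSpace Q M)).map
      (stratumFunPullback hT hQ hfree : _ →ₐ[ℝ] StratumFun T M) = assignmentRing T M := by
  let σ := stratumFunPullback hT hQ hfree
  have hk : ∀ k, (assignments (T ⧸ Q) (QuotientSpace Q M) k).map σ.toLinearMap =
      assignments T M k := fun k => by
    ext A
    obtain ⟨B, rfl⟩ := σ.surjective A
    rw [stratumFunPullback_mem_assignments_iff]
    exact ⟨fun ⟨B', hB', h⟩ => σ.injective h ▸ hB', fun hB => ⟨B, hB, rfl⟩⟩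
  ext A
  rw [mem_assignmentRing]
  simp only [← hk, ← Submodule.map_iSup]
  rfl

/-- The isomorphism from the assignments on `M/Q` to those on `M`. -/
noncomputable def assignmentPullback :
    assignmentRing (T ⧸ Q) (QuotientSpace Q M) ≃ₐ[ℝ] assignmentRing T M :=
  ((stratumFunPullback hT hQ hfree).subalgebraMap _).trans
    (Subalgebra.equivOfEq _ _ (map_stratumFunPullback_assignmentRing hT hQ hfree))

theorem coe_assignmentPullback (B : assignmentRing (T ⧸ Q) (QuotientSpace Q M)) :
    (assignmentPullback hT hQ hfree B : StratumFun T M) =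
      stratumFunPullback hT hQ hfree (B : StratumFun (T ⧸ Q) (QuotientSpace Q M)) := rfl

end StrataEquivalence

/-! ### The splittings of the infinitesimal stabilizers -/

section Splittings

variable {T : Type*} [CommGroup T] [TopologicalSpace T] [IsTopologicalGroup T]
  {M : Type*} [TopologicalSpace M] [T2Space M] [MulAction T M] [ContinuousSMul T M]
  {Q : Subgroup T}

theorem Stratum.fiberLie_singleton_proj (hT : IsTorus T) (hQ : IsTorus Q)
    (hfree : ∀ a ∈ Q, ∀ p : M, a • p = p → a = 1) (X : Stratum T M) {p : M}
    (hp : p ∈ X.carrier) : fiberLie Q {proj Q p} = fiberLie Q (proj Q '' X.carrier) :=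
  (X.image hT hQ hfree).fiberLie_singleton_eq ⟨p, hp, rfl⟩

theorem Stratum.lie_sup_ofSubgroup (hT : IsTorus T) (hQ : IsTorus Q)
    (hfree : ∀ a ∈ Q, ∀ p : M, a • p = p → a = 1) (X : Stratum T M) :
    X.lie ⊔ LieAlg.ofSubgroup Q = fiberLie Q (proj Q '' X.carrier) := by
  obtain ⟨p, hp⟩ := X.nonempty
  rw [← X.fiberLie_singleton_proj hT hQ hfree hp, fiberLie_singleton hQ hfree, X.infStab_eq hp]

theorem ActsThrough.ofSubgroup_kernel_eq_lie (hT : IsTorus T) (hQ : IsTorus Q)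
    (hfree : ∀ a ∈ Q, ∀ p : M, a • p = p → a = 1) {X : Stratum T M}
    {ρ : fiberTorus Q (proj Q '' X.carrier) →* Q} (hρ : ActsThrough ρ X.carrier) :
    LieAlg.ofSubgroup (kernel ρ) = X.lie := by
  obtain ⟨p, hp⟩ := X.nonempty
  rw [hρ.ofSubgroup_kernel_eq_infStab hfree hp (X.fiberLie_singleton_proj hT hQ hfree hp).le,
    X.infStab_eq hp]

/-- Writing `a = exp (ξ + η)` with `ξ` in the infinitesimal stabilizer of `X` and `η` in the Lie
algebra of `Q`, one has `ρ a = exp η`, so the kernel of `ρ` consists of the `exp ξ`. -/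
theorem ActsThrough.kernel_eq_expSubgroup (hT : IsTorus T) (hQ : IsTorus Q)
    (hfree : ∀ a ∈ Q, ∀ p : M, a • p = p → a = 1) {X : Stratum T M}
    {ρ : fiberTorus Q (proj Q '' X.carrier) →* Q} (hρ : ActsThrough ρ X.carrier) :
    kernel ρ = LieAlg.expSubgroup X.lie := by
  obtain ⟨p, hp⟩ := X.nonempty
  have hsup := X.lie_sup_ofSubgroup hT hQ hfree
  ext a
  constructor
  · intro ha
    obtain ⟨⟨ζ, hζ, hζa⟩, -⟩ := mem_kernel_iff.mp ha
    have hap := (hρ.mem_kernel_iff_smul_eq hfree hp ⟨ζ, hζ, hζa⟩).mp ha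
    obtain ⟨ξ, hξ, η, hη, rfl⟩ := Submodule.mem_sup.mp (hsup.symm ▸ hζ)
    rw [← hζa, LieAlg.expAt_add, mul_comm, mul_smul, Stratum.mem_lie.mp hξ p hp] at hap
    refine ⟨ξ, hξ, ?_⟩
    rw [← hζa, LieAlg.expAt_add, hfree _ (hη 1) p hap, mul_one]
  · rintro ⟨ξ, hξ, rfl⟩
    rw [hρ.mem_kernel_iff_smul_eq hfree hp (expAt_mem_expSubgroup (hsup ▸ Submodule.mem_sup_left hξ) 1)]
    exact Stratum.mem_lie.mp hξ p hp 1

/-- The homomorphism `ρ_X`. It is the same for `P = X` and for `P = π⁻¹(closure (X/Q))`, since a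
single point of `X` determines it. -/
theorem Stratum.existsUnique_actsThrough (hT : IsTorus T) (hQ : IsTorus Q)
    (hfree : ∀ a ∈ Q, ∀ p : M, a • p = p → a = 1) (X : Stratum T M) {P : Set M}
    (hXP : X.carrier ⊆ P) (hP : P ⊆ proj Q ⁻¹' closure (proj Q '' X.carrier)) :
    ∃! ρ : fiberTorus Q (proj Q '' X.carrier) →* Q, ActsThrough ρ P := by
  obtain ⟨ρ, hρ⟩ := exists_actsThrough hT hQ hfree (X.image hT hQ hfree)
  exact ⟨ρ, hρ.mono hP, fun ρ' hρ' =>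
    ActsThrough.unique hfree (X.nonempty.mono hXP) (hρ.mono hP) hρ'⟩

/-- A stratum that is open and dense in the component of `F` through a point of `X` dominates `X`,
provided that `X ⊆ F`. -/
theorem le_of_isOpenDenseIn {G N : Type*} [CommGroup G] [TopologicalSpace G]
    [IsTopologicalGroup G] [MulAction G N] [TopologicalSpace N] {X Z : Stratum G N} {F : Set N}
    {p : N} (hp : p ∈ X.carrier) (hXF : X.carrier ⊆ F)
    (hZ : IsOpenDenseIn Z.carrier (connectedComponentIn F p)) : X ≤ Z :=
  (X.isPreconnected.subset_connectedComponentIn hp hXF).trans hZ.2.1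

/-- Both for `Z = X` and for the strata `Z` that are open and dense in a component of the fixed
point set of `ker ρ` meeting `X`, one has `X ≼ Z`, and the Lie algebra of `ker ρ`, which is the
infinitesimal stabilizer of `X`, is contained in that of `Z`. -/
theorem Stratum.le_and_lie_le_of_kernel (hT : IsTorus T) (hQ : IsTorus Q)
    (hfree : ∀ a ∈ Q, ∀ p : M, a • p = p → a = 1) {X Z : Stratum T M}
    {ρ : fiberTorus Q (proj Q '' X.carrier) →* Q} (hρ : ActsThrough ρ X.carrier)
    (hZ : Z.carrier = X.carrier ∨ ∃ p ∈ X.carrier, IsOpenDenseIn Z.carrier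
      (connectedComponentIn (MulAction.fixedPoints (kernel ρ) M) p)) :
    X ≤ Z ∧ X.lie ≤ Z.lie := by
  obtain hZ | ⟨p, hp, hZ⟩ := hZ
  · obtain rfl := Stratum.ext_carrier hZ
    exact ⟨subset_closure, le_rfl⟩
  · refine ⟨le_of_isOpenDenseIn hp ?_ hZ, fun ξ hξ => ?_⟩
    · intro q hq a
      obtain ⟨ha, -⟩ := mem_kernel_iff.mp a.2
      exact (hρ.mem_kernel_iff_smul_eq hfree hq ha).mp a.2
    · rw [← hρ.ofSubgroup_kernel_eq_lie hT hQ hfree] at hξ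
      exact Stratum.mem_lie.mpr fun q hq t =>
        connectedComponentIn_subset _ _ (hZ.1 hq) ⟨ξ.expAt t, hξ t⟩

/-- Both for `Y = X/Q` and for the strata `Y` that are open and dense in a component of the fixed
point set of `K/Q` meeting `X/Q`, one has `X/Q ≼ Y`, and the infinitesimal stabilizer of `X/Q` is
contained in that of `Y`. -/
theorem Stratum.image_le_and_lie_image_le (hT : IsTorus T) (hQ : IsTorus Q)
    (hfree : ∀ a ∈ Q, ∀ p : M, a • p = p → a = 1) {X : Stratum T M}
    {Y : Stratum (T ⧸ Q) (QuotientSpace Q M)}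
    (hY : Y.carrier = proj Q '' X.carrier ∨ ∃ p ∈ X.carrier, IsOpenDenseIn Y.carrier
      (connectedComponentIn (MulAction.fixedPoints
        ((fiberTorus Q (proj Q '' X.carrier)).map (QuotientGroup.mk' Q))
        (QuotientSpace Q M)) (proj Q p))) :
    X.image hT hQ hfree ≤ Y ∧ (X.image hT hQ hfree).lie ≤ Y.lie := by
  obtain hY | ⟨p, hp, hY⟩ := hY
  · obtain rfl : Y = X.image hT hQ hfree := Stratum.ext_carrier hY
    exact ⟨subset_closure, le_rfl⟩
  · refine ⟨le_of_isOpenDenseIn ⟨p, hp, rfl⟩ ?_ hY, ?_⟩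
    · rintro _ ⟨q, hq, rfl⟩ ⟨_, a, ha, rfl⟩
      exact fiberTorus_le_fiberStabilizer _ ha q ⟨q, hq, rfl⟩
    · rw [X.lie_image]
      rintro _ ⟨ξ, hξ, rfl⟩
      have hξK : ξ ∈ fiberLie Q (proj Q '' X.carrier) :=
        X.lie_sup_ofSubgroup hT hQ hfree ▸ Submodule.mem_sup_left hξ
      exact Stratum.mem_lie.mpr fun y hy t =>
        connectedComponentIn_subset _ _ (hY.1 hy)
          ⟨_, ξ.expAt t, expAt_mem_expSubgroup hξK t, rfl⟩

end Splittings

end TorusAssignment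

open TorusAssignment in
theorem mainTheorem8
    {E : Type*} [NormedAddCommGroup E] [NormedSpace ℝ E] [FiniteDimensional ℝ E]
    {T : Type*} [CommGroup T] [TopologicalSpace T] [IsTopologicalGroup T]
    [ChartedSpace E T] [LieGroup 𝓘(ℝ, E) ∞ T] (hT : IsTorus T)
    {F : Type*} [NormedAddCommGroup F] [NormedSpace ℝ F] [FiniteDimensional ℝ F]
    {M : Type*} [TopologicalSpace M] [T2Space M] [ChartedSpace F M] [IsManifold 𝓘(ℝ, F) ∞ M]
    [MulAction T M] [ContMDiffSMul 𝓘(ℝ, E) 𝓘(ℝ, F) ∞ T M]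
    (Q : Subgroup T) (hQ : IsTorus Q)
    (hfree : ∀ a ∈ Q, ∀ p : M, a • p = p → a = 1) :
    -- the morphisms `ρ_X : K_X → Q` and the splittings for the strata `X` of `M/Q`
    (∀ X : Stratum (T ⧸ Q) (QuotientSpace Q M),
      Q ≤ fiberTorus Q X.carrier ∧
      LieAlg.ofSubgroup (fiberTorus Q X.carrier) = fiberLie Q X.carrier ∧
      (∃! ρ : fiberTorus Q X.carrier →* Q, ActsThrough ρ (proj Q ⁻¹' closure X.carrier)) ∧
      (∃ Z : Stratum T M, Z.carrier = proj Q ⁻¹' X.carrier) ∧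
      ∀ ρ : fiberTorus Q X.carrier →* Q, ActsThrough ρ (proj Q ⁻¹' closure X.carrier) →
        Continuous ρ ∧ Function.Surjective ρ ∧
        Disjoint (LieAlg.ofSubgroup (kernel ρ)) (LieAlg.ofSubgroup Q) ∧
        LieAlg.ofSubgroup (kernel ρ) ⊔ LieAlg.ofSubgroup Q = fiberLie Q X.carrier ∧
        Set.BijOn (LieAlg.toQuotient Q) (LieAlg.ofSubgroup (kernel ρ)) X.lie) ∧
    -- the morphisms `ρ_X : K_X → Q` and the splittings for the strata `X` of `M`
    (∀ X : Stratum T M,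
      (∀ p ∈ X.carrier, fiberLie Q {proj Q p} = fiberLie Q (proj Q '' X.carrier)) ∧
      (∃ Y : Stratum (T ⧸ Q) (QuotientSpace Q M), Y.carrier = proj Q '' X.carrier ∧
        Set.BijOn (LieAlg.toQuotient Q) X.lie Y.lie) ∧
      Disjoint X.lie (LieAlg.ofSubgroup Q) ∧
      X.lie ⊔ LieAlg.ofSubgroup Q = fiberLie Q (proj Q '' X.carrier) ∧
      (∃! ρ : fiberTorus Q (proj Q '' X.carrier) →* Q, ActsThrough ρ X.carrier) ∧
      ∀ ρ : fiberTorus Q (proj Q '' X.carrier) →* Q, ActsThrough ρ X.carrier →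
        Continuous ρ ∧ Function.Surjective ρ ∧ kernel ρ = LieAlg.expSubgroup X.lie) ∧
    -- the isomorphism `π_*` of graded algebras and its inverse `σ`
    ∃ π : assignmentRing T M ≃ₐ[ℝ] assignmentRing (T ⧸ Q) (QuotientSpace Q M),
      (∀ (k : ℕ) (A : assignmentRing T M),
        (π A : StratumFun (T ⧸ Q) (QuotientSpace Q M)) ∈ assignments (T ⧸ Q) (QuotientSpace Q M) k ↔
          (A : StratumFun T M) ∈ assignments T M k) ∧
      (∀ (X : Stratum (T ⧸ Q) (QuotientSpace Q M)) (ρ : fiberTorus Q X.carrier →* Q),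
        ActsThrough ρ (proj Q ⁻¹' closure X.carrier) → ∀ Z : Stratum T M,
          (Z.carrier = proj Q ⁻¹' X.carrier ∨
            ∃ p ∈ proj Q ⁻¹' X.carrier, IsOpenDenseIn Z.carrier
              (connectedComponentIn (MulAction.fixedPoints (kernel ρ) M) p)) →
          ∀ A : assignmentRing T M,
            Corresponds (LieAlg.ofSubgroup (kernel ρ)) A Z (π A) X) ∧
      (∀ (X : Stratum T M) (Y : Stratum (T ⧸ Q) (QuotientSpace Q M)),
        (Y.carrier = proj Q '' X.carrier ∨
          ∃ p ∈ X.carrier, IsOpenDenseIn Y.carrier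
            (connectedComponentIn (MulAction.fixedPoints
              ((fiberTorus Q (proj Q '' X.carrier)).map (QuotientGroup.mk' Q))
              (QuotientSpace Q M)) (proj Q p))) →
          ∀ B : assignmentRing (T ⧸ Q) (QuotientSpace Q M),
            Corresponds X.lie (π.symm B) X B Y) := by

  have : ContinuousSMul T M :=
    ContMDiffSMul.continuousSMul (I := 𝓘(ℝ, E)) (I' := 𝓘(ℝ, F)) ∞
  have := hQ.compactSpace
  refine ⟨fun Y => ?_, fun X => ?_, (assignmentPullback hT hQ hfree).symm, fun k A => ?_,
    fun Y ρ hρ Z hZ A => ?_, fun X Y hY B ξ hξ => ?_⟩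
  · obtain ⟨X, rfl⟩ := Stratum.image_surjective hT hQ hfree Y
    refine ⟨le_fiberTorus hQ _, ofSubgroup_fiberTorus _,
      X.existsUnique_actsThrough hT hQ hfree (subset_preimage_closure_image_proj _) subset_rfl,
      ⟨X, (X.preimage_image hT hQ hfree).symm⟩, fun ρ hρ => ?_⟩
    have hρX : ActsThrough ρ X.carrier := hρ.mono (subset_preimage_closure_image_proj _)
    have hker : LieAlg.ofSubgroup (kernel ρ) = X.lie := hρX.ofSubgroup_kernel_eq_lie hT hQ hfree
    rw [hker]
    exact ⟨hρX.continuous hfree X.nonempty, hρX.surjective hQ hfree X.nonempty,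
      X.disjoint_lie hfree, X.lie_sup_ofSubgroup hT hQ hfree, X.bijOn_lie_image hT hQ hfree⟩
  · exact ⟨fun p hp => X.fiberLie_singleton_proj hT hQ hfree hp,
      ⟨X.image hT hQ hfree, rfl, X.bijOn_lie_image hT hQ hfree⟩, X.disjoint_lie hfree,
      X.lie_sup_ofSubgroup hT hQ hfree,
      X.existsUnique_actsThrough hT hQ hfree subset_rfl (subset_preimage_closure_image_proj _),
      fun ρ hρ => ⟨hρ.continuous hfree X.nonempty, hρ.surjective hQ hfree X.nonempty,
        hρ.kernel_eq_expSubgroup hT hQ hfree⟩⟩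
  · obtain ⟨B, rfl⟩ := (assignmentPullback hT hQ hfree).surjective A
    rw [AlgEquiv.symm_apply_apply, coe_assignmentPullback, stratumFunPullback_mem_assignments_iff]
  · obtain ⟨X, rfl⟩ := Stratum.image_surjective hT hQ hfree Y
    obtain ⟨B, rfl⟩ := (assignmentPullback hT hQ hfree).surjective A
    have hρX : ActsThrough ρ X.carrier := hρ.mono (subset_preimage_closure_image_proj _)
    rw [X.preimage_image hT hQ hfree] at hZ
    obtain ⟨hXZ, hlie⟩ := Stratum.le_and_lie_le_of_kernel hT hQ hfree hρX hZ
    intro ξ hξ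
    have hξX : ξ ∈ X.lie := hρX.ofSubgroup_kernel_eq_lie hT hQ hfree ▸ hξ
    refine ⟨(X.bijOn_lie_image hT hQ hfree).mapsTo hξX, hlie hξX, ?_⟩
    rw [apply_eq_of_mem_assignmentRing (assignmentPullback hT hQ hfree B).2 hXZ (hlie hξX) hξX,
      AlgEquiv.symm_apply_apply]
    rfl
  · obtain ⟨hXY, hlie⟩ := Stratum.image_le_and_lie_image_le hT hQ hfree hY
    have hξ' := (X.bijOn_lie_image hT hQ hfree).mapsTo hξ
    exact ⟨hlie hξ', hξ, apply_eq_of_mem_assignmentRing B.2 hXY (hlie hξ') hξ'⟩
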